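/- **Notation.** For $u\in L^1(\mathbb R)$ let $u^*(x)=\int e^{ixt}u(t)\,dt$. Let $X_i,\varepsilon_i$ be real random variables and $Z_i=X_i+\varepsilon_i$, where the $\varepsilon_i$ are i.i.d. with density $f_\varepsilon$ and each $X_i$ has density $g$. Let $\psi:\mathbb R\to\mathbb R$ and $\theta=\int\psi g$. The $\beta$-mixing coefficient $\beta_k$ of a process is the supremum over $l$ of $\tfrac12\sum_{i,j}|P(U_i\cap V_j)-P(U_i)P(V_j)|$, taken over all finite partitions $(U_i)$ measurable for the process up to time $l$ and $(V_j)$ measurable for the process from time $l+k$ on. For $n,m,j\in\mathbb N$, $n\ge 2$, put $$\hat\theta_m=\frac1{2\pi n}\sum_{k=1}^n\int_{|t|\le\pi m}e^{itZ_k}\frac{\psi^*(-t)}{f_\varepsilon^*(t)}\,dt ,\qquad C_\varepsilon=\int|f_\varepsilon^*|\in(0,\infty],\qquad I_{j,m}=\{x:\pi(j\wedge m)\le|x|\le\pi(j\vee m)\},$$ $$\sigma_{j,m}^2=\frac{2}{2\pi n}\min\Big\{C_\varepsilon\int_{I_{j,m}}\Big|\frac{\psi^*}{f_\varepsilon^*}\Big|^2,\Big(\int_{I_{j,m}}\Big|\frac{\psi^*}{f_\varepsilon^*}\Big|\Big)^2\Big\},\qquad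 c_{j,m}=\frac{2\ln n}{c}\cdot\frac{1}{2\pi n}\int_{I_{j,m}}\Big|\frac{\psi^*}{f_\varepsilon^*}\Big| ,$$ $\sigma_m^2=\sigma_{0,m}^2$, $c_m=c_{0,m}$, $\omega_m^2=(\sigma_m^2\vee c_m)+2(\sigma_m^2\vee c_m)^2$. For $a>0$, a finite non-empty $\mathcal M\subset\mathbb N$ and positive weights $(x_m)_{m\in\mathcal M}$, put $$\mathrm{pen}(m)=4\Big(1+\frac1a\Big)(x_m\sigma_m^2+x_m^2c_m^2),\qquad H(j,m)=4\Big(1+\frac1a\Big)(x_j\sigma_{j,m}^2+x_j^2c_{j,m}^2),$$ $$\widehat{\mathrm{Crit}}(m)=\sup_{j\ge m,\,j\in\mathcal M}\big[(\hat\theta_m-\hat\theta_j)^2-H(j,m)\big]+\mathrm{pen}(m),\qquad \hat m=\inf\Big\{m\in\mathcal M:\widehat{\mathrm{Crit}}(m)\le\inf_{j\in\mathcal M}\widehat{\mathrm{Crit}}(j)+\frac1n\Big\}.$$ **Assumptions.** $\psi g,\psi,\psi^*g^*\in L^1(\mathbb R)$; $f_\varepsilon\in L^2(\mathbb R)$ and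 $f_\varepsilon^*(x)\ne0$ for all $x$; $\int|\psi^*|<\infty$, $\int|\psi^*/f_\varepsilon^*|=+\infty$ and $\int|\psi^*/f_\varepsilon^*|^2=+\infty$; and, for some $c>0$, one of the following holds. * (D1) The sequences $(X_i)$ and $(\varepsilon_i)$ are independent, and $(X_i)$ is strongly stationary and $\beta$-mixing with $\beta_k\le e^{-ck}$ for all $k\in\mathbb N$. * (D2) For every $i$, $\varepsilon_i$ is independent of $(X_i,(X_j,\varepsilon_j)_{j<i})$; the sequence $(Z_i,X_i)$ is strongly stationary and $\beta$-mixing with $\beta_k\le e^{-ck}$ for all $k\in\mathbb N$. Moreover, for some $\kappa_0,\kappa_0',\gamma,\alpha,\rho,A,R\ge0$, $C_\psi,C'_\psi>0$, $B\in\mathbb R$, with $\alpha=0\Leftrightarrow\rho=0$, $A=0\Leftrightarrow R=0$, and $\gamma>1$ if $\rho=0$, for all $x\in\mathbb R$, $$\kappa_0(x^2+1)^{-\gamma/2}e^{-\alpha|x|^\rho}\le|f_\varepsilon^*(x)|\le\kappa_0'(x^2+1)^{-\gamma/2}e^{-\alpha|x|^\rho},$$ $$C'_\psi(x^2+1)^{-B}e^{-2A|x|^R}\le|\psi^*(x)|^2\le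 C_\psi(x^2+1)^{-B}e^{-2A|x|^R},$$ and either $\gamma>\max(B,1)$, or $A>0$ and $\rho>0$. **Conclusion.** There are a constant $C(a)>0$ depending only on $a$ and a constant $C'>0$ depending only on $a,c,\psi,f_\varepsilon$ such that, for all $n\ge2$, all finite non-empty $\mathcal M\subset\mathbb N$ and all positive weights $(x_m)_{m\in\mathcal M}$, $$\mathbb E\big[(\hat\theta_{\hat m}-\theta)^2\big]\le C(a)\inf_{m\in\mathcal M}\Big\{\Big(\int_{|x|\ge\pi m}|\psi^*(x)g^*(x)|\,dx\Big)^2+\mathrm{pen}(m)\Big\}+C(a)\sum_{m\in\mathcal M}e^{-x_m}\omega_m^2+\frac{C'}{n}.$$ -/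

import Mathlib

open MeasureTheory ProbabilityTheory

noncomputable section

namespace Deconv

/-! ### Fourier transforms, densities and smoothness classes -/

/-- The Fourier transform `u^*(x) = ∫ e^{ixt} u(t) dt` of a real function `u`. -/
def ft (u : ℝ → ℝ) (x : ℝ) : ℂ :=
  ∫ t : ℝ, Complex.exp (Complex.I * x * t) * (u t : ℂ)

/-- `f` is a (measurable, non-negative) Lebesgue density of the law `ν`. -/
structure IsDensityOf (f : ℝ → ℝ) (ν : Measure ℝ) : Prop where
  measurable : Measurable f
  nonneg : ∀ x, 0 ≤ f x
  law_eq : ν = volume.withDensity (fun x => ENNReal.ofReal (f x))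

/-- Standing integrability assumptions on `ψ`, the noise density `f` and the density `g`. -/
structure Standing (ψ f g : ℝ → ℝ) : Prop where
  integrable_mul : Integrable (fun x => ψ x * g x)
  integrable_psi : Integrable ψ
  integrable_ft_mul : Integrable (fun x => ft ψ x * ft g x)
  memLp_two : MemLp f 2
  ft_ne_zero : ∀ x, ft f x ≠ 0

/-- Two-sided smoothness condition on the noise:
`κ₀ (x²+1)^{-γ/2} e^{-α|x|^ρ} ≤ |f^*(x)| ≤ κ₁ (x²+1)^{-γ/2} e^{-α|x|^ρ}`, with the convention that
`α = 0` if and only if `ρ = 0`, and `γ > 1` when `ρ = 0`. -/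
structure NoiseSmooth (f : ℝ → ℝ) (κ₀ κ₁ γ α ρ : ℝ) : Prop where
  κ₀_nonneg : 0 ≤ κ₀
  κ₁_nonneg : 0 ≤ κ₁
  γ_nonneg : 0 ≤ γ
  α_nonneg : 0 ≤ α
  ρ_nonneg : 0 ≤ ρ
  convention : α = 0 ↔ ρ = 0
  one_lt_γ : ρ = 0 → 1 < γ
  lower : ∀ x : ℝ, κ₀ * (x ^ 2 + 1) ^ (-γ / 2) * Real.exp (-α * |x| ^ ρ) ≤ ‖ft f x‖
  upper : ∀ x : ℝ, ‖ft f x‖ ≤ κ₁ * (x ^ 2 + 1) ^ (-γ / 2) * Real.exp (-α * |x| ^ ρ)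

/-- Two-sided smoothness condition on `ψ`:
`C₁ (x²+1)^{-B} e^{-2A|x|^R} ≤ |ψ^*(x)|² ≤ C₂ (x²+1)^{-B} e^{-2A|x|^R}`, with the convention that
`A = 0` if and only if `R = 0`. -/
structure FunctionalSmooth (ψ : ℝ → ℝ) (C₁ C₂ B A R : ℝ) : Prop where
  C₁_pos : 0 < C₁
  C₂_pos : 0 < C₂
  A_nonneg : 0 ≤ A
  R_nonneg : 0 ≤ R
  convention : A = 0 ↔ R = 0
  lower : ∀ x : ℝ, C₁ * (x ^ 2 + 1) ^ (-B) * Real.exp (-2 * A * |x| ^ R) ≤ ‖ft ψ x‖ ^ 2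
  upper : ∀ x : ℝ, ‖ft ψ x‖ ^ 2 ≤ C₂ * (x ^ 2 + 1) ^ (-B) * Real.exp (-2 * A * |x| ^ R)

/-! ### Stationarity and β-mixing -/

section Mixing

variable {Ω : Type*} [MeasurableSpace Ω] {E : Type*} [MeasurableSpace E]

/-- The β-mixing (absolute regularity) coefficient of two σ-algebras `m₁`, `m₂`:
the supremum of `½ ∑ᵢ ∑ⱼ |P(Uᵢ ∩ Vⱼ) - P(Uᵢ) P(Vⱼ)|` over all finite partitions `(Uᵢ)` into
`m₁`-measurable sets and `(Vⱼ)` into `m₂`-measurable sets. The partitions are given as the level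
sets of measurable functions with values in `Fin p` and `Fin q`. -/
def betaCoeff (μ : Measure Ω) (m₁ m₂ : MeasurableSpace Ω) : ENNReal :=
  ⨆ (p : ℕ) (q : ℕ) (u : Ω → Fin p) (v : Ω → Fin q)
    (_ : Measurable[m₁] u) (_ : Measurable[m₂] v),
    ENNReal.ofReal ((1 / 2) * ∑ i : Fin p, ∑ j : Fin q,
      |μ.real (u ⁻¹' {i} ∩ v ⁻¹' {j}) - μ.real (u ⁻¹' {i}) * μ.real (v ⁻¹' {j})|)

/-- The β-mixing coefficients of a process: `β_k` is the supremum over `l` of the coefficient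
between the past `σ(ξ_i, i ≤ l)` and the future `σ(ξ_i, i ≥ l + k)`. -/
def betaMixing (μ : Measure Ω) (ξ : ℕ → Ω → E) (k : ℕ) : ENNReal :=
  ⨆ l : ℕ, betaCoeff μ
    (⨆ i : {i : ℕ // i ≤ l}, MeasurableSpace.comap (ξ i) inferInstance)
    (⨆ i : {i : ℕ // l + k ≤ i}, MeasurableSpace.comap (ξ i) inferInstance)

/-- Strong (strict) stationarity: the law of the sequence is invariant under shifts. -/
def StronglyStationary (μ : Measure Ω) (ξ : ℕ → Ω → E) : Prop :=
  ∀ h : ℕ, μ.map (fun ω i => ξ (i + h) ω) = μ.map (fun ω i => ξ i ω)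

/-- The process is strongly stationary and geometrically β-mixing: `β_k ≤ e^{-ck}` for all `k`. -/
structure GeomMixing (μ : Measure Ω) (ξ : ℕ → Ω → E) (c : ℝ) : Prop where
  stationary : StronglyStationary μ ξ
  beta_le : ∀ k : ℕ, betaMixing μ ξ k ≤ ENNReal.ofReal (Real.exp (-c * k))

end Mixing

/-! ### The model `Z_i = X_i + ε_i` and its dependence contexts -/

section Model

variable {Ω : Type*} [MeasurableSpace Ω]

/-- The observations `Z_i = X_i + ε_i`. -/
def obs (X ε : ℕ → Ω → ℝ) (i : ℕ) (ω : Ω) : ℝ := X i ω + ε i ω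

/-- Common part of both contexts: `X_i` has density `g` and the `ε_i` are i.i.d. with density
`f`. -/
structure Model (μ : Measure Ω) (X ε : ℕ → Ω → ℝ) (f g : ℝ → ℝ) : Prop where
  measurable_X : ∀ i, Measurable (X i)
  measurable_ε : ∀ i, Measurable (ε i)
  density_X : ∀ i, IsDensityOf g (μ.map (X i))
  density_ε : ∀ i, IsDensityOf f (μ.map (ε i))
  indep_ε : iIndepFun ε μ

/-- First context: the sequences `(X_i)` and `(ε_i)` are independent, and `(X_i)` is stationary
and geometrically β-mixing. -/
structure ContextD1 (μ : Measure Ω) (X ε : ℕ → Ω → ℝ) (c : ℝ) : Prop where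
  indep : IndepFun (fun ω i => X i ω) (fun ω i => ε i ω) μ
  mixing : GeomMixing μ X c

/-- Second context (ARCH type): for every `i`, the noise `ε_i` is independent of `X_i`, jointly
with the past `(X_j, ε_j)`, `j < i` (the sequences `(X_i)` and `(ε_i)` need not be independent),
and `(Z_i, X_i)` is stationary and geometrically β-mixing. -/
structure ContextD2 (μ : Measure Ω) (X ε : ℕ → Ω → ℝ) (c : ℝ) : Prop where
  indep : ∀ i : ℕ,
    IndepFun (ε i) (fun ω => (X i ω, fun j : Fin i => (X j ω, ε j ω))) μ
  mixing : GeomMixing μ (fun i ω => (obs X ε i ω, X i ω)) c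

end Model

/-! ### The estimators and the selection procedure -/

/-- The linear functional `θ(g) = ∫ ψ g`. -/
def theta (ψ g : ℝ → ℝ) : ℝ := ∫ x, ψ x * g x

/-- The estimator
`θ̂_m = (1/(2πn)) ∑_{k=1}^n ∫_{|t| ≤ πm} e^{itz_k} ψ^*(-t) / f^*(t) dt`, as a function of the data
`z`. The integral is real because `ψ` and `f` are, so taking the real part changes nothing. -/
def thetaHat (ψ f : ℝ → ℝ) (n m : ℕ) (z : ℕ → ℝ) : ℝ :=
  (1 / (2 * Real.pi * n)) * ∑ k ∈ Finset.Icc 1 n,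
    (∫ t in {t : ℝ | |t| ≤ Real.pi * m},
      Complex.exp (Complex.I * t * z k) * (ft ψ (-t) / ft f t)).re

/-- The region `π (j ∧ m) ≤ |x| ≤ π (j ∨ m)`. -/
def annulus (j m : ℕ) : Set ℝ :=
  {x : ℝ | Real.pi * (min j m : ℕ) ≤ |x| ∧ |x| ≤ Real.pi * (max j m : ℕ)}

/-- `C_ε = ∫ |f^*|`, possibly infinite. -/
def Ceps (f : ℝ → ℝ) : ENNReal := ∫⁻ x, ‖ft f x‖ₑ

/-- `σ²_{j,m} = (1/(2πn)) min {C_ε ∫ |ψ^*/f^*|², (∫ |ψ^*/f^*|)²}`, the integrals being over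
the region between `π (j ∧ m)` and `π (j ∨ m)`. -/
def sigmaSq (ψ f : ℝ → ℝ) (n j m : ℕ) : ℝ :=
  (1 / (2 * Real.pi * n)) *
    (min (Ceps f * ∫⁻ x in annulus j m, ‖ft ψ x / ft f x‖ₑ ^ 2)
      ((∫⁻ x in annulus j m, ‖ft ψ x / ft f x‖ₑ) ^ 2)).toReal

/-- `c_{j,m} = (1/(2πn)) ∫ |ψ^*/f^*|` over the same region. -/
def cConst (ψ f : ℝ → ℝ) (n j m : ℕ) : ℝ :=
  (1 / (2 * Real.pi * n)) * ∫ x in annulus j m, ‖ft ψ x / ft f x‖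

/-- The variance terms of the dependent case: `2 σ²_{j,m}`. -/
def sigmaSqMix (ψ f : ℝ → ℝ) (n j m : ℕ) : ℝ := 2 * sigmaSq ψ f n j m

/-- The sup-norm terms of the dependent case: `2 c_{j,m} ln(n) / c`. -/
def cMix (ψ f : ℝ → ℝ) (c : ℝ) (n j m : ℕ) : ℝ :=
  2 * cConst ψ f n j m * Real.log n / c

/-- The bias correction `H(j,m) = 4 (1 + 1/a) (x_j σ²_{j,m} + x_j² c_{j,m}²)`, for given
variance terms `s j m = σ²_{j,m}` and sup-norm terms `d j m = c_{j,m}`. -/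
def corr (a : ℝ) (x : ℕ → ℝ) (s d : ℕ → ℕ → ℝ) (j m : ℕ) : ℝ :=
  4 * (1 + 1 / a) * (x j * s j m + x j ^ 2 * d j m ^ 2)

/-- The penalty `pen(m) = 4 (1 + 1/a) (x_m σ²_m + x_m² c_m²)`, where `σ²_m = σ²_{0,m}` and
`c_m = c_{0,m}`. -/
def pen (a : ℝ) (x : ℕ → ℝ) (s d : ℕ → ℕ → ℝ) (m : ℕ) : ℝ :=
  4 * (1 + 1 / a) * (x m * s 0 m + x m ^ 2 * d 0 m ^ 2)

/-- `ω²_m = σ²_m ∨ c_m + 2 (σ²_m ∨ c_m)²`. -/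
def omegaSq (s d : ℕ → ℕ → ℝ) (m : ℕ) : ℝ :=
  max (s 0 m) (d 0 m) + 2 * max (s 0 m) (d 0 m) ^ 2

/-- The empirical criterion
`sup_{j ≥ m, j ∈ 𝓜} [(θ̂_m - θ̂_j)² - H(j,m)] + pen(m)`, where `T m` is the value of `θ̂_m`. -/
def critHat (M : Finset ℕ) (a : ℝ) (x : ℕ → ℝ) (s d : ℕ → ℕ → ℝ) (T : ℕ → ℝ) (m : ℕ) : ℝ :=
  (⨆ j : {j : ℕ // j ∈ M ∧ m ≤ j}, ((T m - T j) ^ 2 - corr a x s d j m)) + pen a x s d m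

/-- The selected model `m̂ = inf {m ∈ 𝓜 : Crit(m) ≤ inf_{j ∈ 𝓜} Crit(j) + 1/n}`, with `Crit`
the empirical criterion. -/
def mHat (M : Finset ℕ) (n : ℕ) (a : ℝ) (x : ℕ → ℝ) (s d : ℕ → ℕ → ℝ) (T : ℕ → ℝ) : ℕ :=
  sInf {m : ℕ | m ∈ M ∧ critHat M a x s d T m ≤ (⨅ j : M, critHat M a x s d T j) + 1 / n}

/-- The adaptive estimator `θ̂_{m̂}` in the dependent case, as a function of the data `z`. -/
def adaptiveEstimator (ψ f : ℝ → ℝ) (c a : ℝ) (n : ℕ) (M : Finset ℕ) (x : ℕ → ℝ)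
    (z : ℕ → ℝ) : ℝ :=
  thetaHat ψ f n
    (mHat M n a x (sigmaSqMix ψ f n) (cMix ψ f c n) (fun m => thetaHat ψ f n m z)) z

/-- The bias bound `∫_{|x| ≥ πm} |ψ^*(x) g^*(x)| dx`. -/
def biasBound (ψ g : ℝ → ℝ) (m : ℕ) : ℝ :=
  ∫ x in {x : ℝ | Real.pi * m ≤ |x|}, ‖ft ψ x * ft g x‖

end Deconv

end

/-! Split each summand of `θ̂_j - θ̂_m` by averaging over its noise variable. Since the
characteristic function of the noise is `f^*`, this average cancels the denominator of `ψ^*(-t) /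
f^*(t)`: what remains is a state part with kernel `ψ^*(-t)`, and the difference is a noise part.

State part. After subtraction of its target it is an integral over the annulus of `ψ^*(-t)` times
the deviation of the empirical characteristic function of the `X_k` from `g^*`. As `ψ^*` is
integrable, extending the integral to the whole line bounds it for all models at once by `empLoss`.
Mixing makes the covariances of `cos (t X_k)` and of `sin (t X_k)` decay geometrically, so the
second moment of `empLoss` is of order `1/n`. This is the only use of mixing; no coupling with
independent blocks is made.

Noise part. In both contexts `ε_k` is independent of `X_k` and of the past (`NoiseIndep`), so this
part is a sum of bounded variables centred given state and past. Integrating out the last noise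
variable repeatedly bounds its Laplace transform, which yields an integrated Bernstein inequality
(`CentredNoise.integral_max_sq_sub_le`). Its conditional variance is at most the minimum in
`sigmaSq` (`integral_trig_add_sq_le`). One bound on the second moment is trivial; the other
symmetrises the double integral of `h(s) h(t)` against the kernel `f^*(s - t)`.

Selection. `sq_selected_sub_le` is a pathwise comparison of Goldenshluger-Lepski type: the selected
error is bounded by squared bias, penalty, excess of the squared noise parts over half corrections,
and the squared state remainder. Taking expectations gives the result, the supremum over models
being replaced by a sum.

Small samples. The Bernstein step needs `ln n ≥ 2c`. Otherwise `n` is bounded: large weights kill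
the excess outright, models of large variance are absorbed by the square in `omegaSq`, and only
finitely many models remain because the variance terms tend to infinity. They contribute to `C'`
alone. -/

noncomputable section

/-! ### Fourier inversion and Parseval's formula for `ft` -/

namespace Deconv

/-- **Fourier inversion almost everywhere**, without continuity of the function. -/
theorem fourierInv_fourier_ae_eq {u : ℝ → ℂ} (hu : Integrable u)
    (hu' : Integrable (FourierTransform.fourier u)) :
    ∀ᵐ x, u x = FourierTransformInv.fourierInv (FourierTransform.fourier u) x := by
  have hcont : Continuous (FourierTransformInv.fourierInv (FourierTransform.fourier u)) := by
    have h : FourierTransformInv.fourierInv (FourierTransform.fourier u)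
        = FourierTransform.fourier (fun x => FourierTransform.fourier u (-x)) :=
      Real.fourierInv_eq_fourier_comp_neg _
    rw [h]
    exact VectorFourier.fourierIntegral_continuous Real.continuous_fourierChar
      continuous_inner hu'.comp_neg
  -- The multiplication formula, which moves the transform from one factor of an integral to the
  -- other.
  have flip : ∀ p q : ℝ → ℂ, Integrable p → Integrable q →
      ∫ x, FourierTransform.fourier p x * q x = ∫ x, p x * FourierTransform.fourier q x := by
    intro p q hp hq
    have := VectorFourier.integral_fourierIntegral_smul_eq_flip (μ := volume) (ν := volume)
      (L := innerₗ ℝ) Real.continuous_fourierChar continuous_inner hp hq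
    simpa [Real.fourier_eq, VectorFourier.fourierIntegral, real_inner_comm, flip_innerₗ] using this
  refine ae_eq_of_integral_contDiff_smul_eq hu.locallyIntegrable hcont.locallyIntegrable ?_
  intro φ hφ hφc
  have hc : HasCompactSupport (fun x => (φ x : ℂ)) :=
    hφc.comp_left (g := fun x : ℝ => (x : ℂ)) (by simp)
  have hd : ContDiff ℝ (⊤ : ℕ∞) (fun x => (φ x : ℂ)) := Complex.ofRealCLM.contDiff.comp hφ
  set F : SchwartzMap ℝ ℂ := hc.toSchwartzMap hd with hF
  have hFφ : ∀ x, F x = (φ x : ℂ) := fun x => rfl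
  -- The test function is written as the transform of a Schwartz function, so the transform can be
  -- moved onto `u` and back.
  set S : SchwartzMap ℝ ℂ := FourierTransformInv.fourierInv F with hS
  have hSF : FourierTransform.fourier (S : ℝ → ℂ) = F := by
    rw [← SchwartzMap.fourier_coe, hS, FourierTransform.fourier_fourierInv_eq]
  have hSinv : (S : ℝ → ℂ) = FourierTransform.fourier (fun x => F (-x)) := by
    rw [hS, SchwartzMap.fourierInv_coe, Real.fourierInv_eq_fourier_comp_neg]
  calc ∫ x, φ x • u x = ∫ x, FourierTransform.fourier (S : ℝ → ℂ) x * u x := by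
        rw [hSF]; simp [hFφ]
    _ = ∫ x, S x * FourierTransform.fourier u x := flip _ _ S.integrable hu
    _ = ∫ x, FourierTransform.fourier (fun x => F (-x)) x * FourierTransform.fourier u x := by
        rw [← hSinv]
    _ = ∫ x, F (-x) * FourierTransform.fourier (FourierTransform.fourier u) x :=
        flip _ _ F.integrable.comp_neg hu'
    _ = ∫ x, F x * FourierTransform.fourier (FourierTransform.fourier u) (-x) := by
        rw [← integral_neg_eq_self]; simp
    _ = _ := by
        simp [hFφ, Real.fourierInv_eq_fourier_neg]

lemma norm_cexp_I_mul (x t : ℝ) : ‖Complex.exp (Complex.I * x * t)‖ = 1 := by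
  rw [Complex.norm_exp]; simp

lemma ft_eq_fourier (u : ℝ → ℝ) (x : ℝ) :
    ft u x = FourierTransform.fourier (fun t => (u t : ℂ)) (-x / (2 * Real.pi)) := by
  rw [Real.fourier_real_eq_integral_exp_smul, ft]
  congr 1 with t
  rw [smul_eq_mul]
  congr 2
  push_cast
  field_simp

lemma continuous_ft {u : ℝ → ℝ} (hu : Integrable u) : Continuous (ft u) := by
  refine continuous_of_dominated (bound := fun t => ‖u t‖) ?_ ?_ hu.norm ?_
  · intro x
    exact (Continuous.aestronglyMeasurable (by fun_prop)).mul
      hu.ofReal.aestronglyMeasurable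
  · intro x
    exact Filter.Eventually.of_forall fun t => by simp [norm_cexp_I_mul]
  · exact Filter.Eventually.of_forall fun t => by fun_prop

lemma ft_neg (u : ℝ → ℝ) (x : ℝ) : ft u (-x) = (starRingEnd ℂ) (ft u x) := by
  rw [ft, ft, ← integral_conj]
  congr 1 with t
  rw [map_mul, ← Complex.exp_conj]
  simp

lemma norm_ft_neg (u : ℝ → ℝ) (x : ℝ) : ‖ft u (-x)‖ = ‖ft u x‖ := by
  rw [ft_neg, RCLike.norm_conj]

/-- Inversion formula for the transform `ft`. -/
theorem ae_eq_integral_ft {u : ℝ → ℝ} (hu : Integrable u) (hu' : Integrable (ft u)) :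
    ∀ᵐ x, (u x : ℂ)
      = (1 / (2 * Real.pi) : ℝ) * ∫ t : ℝ, Complex.exp (Complex.I * x * t) * ft u (-t) := by
  have hpi : (2 * Real.pi) ≠ 0 := by positivity
  have hF : FourierTransform.fourier (fun t => (u t : ℂ)) = fun v => ft u (-(2 * Real.pi) * v) := by
    ext v
    rw [ft_eq_fourier]; field_simp
  have hFi : Integrable (FourierTransform.fourier (fun t => (u t : ℂ))) := by
    rw [hF]
    exact hu'.comp_mul_left' (neg_ne_zero.2 hpi)
  have huC : Integrable (fun t => (u t : ℂ)) := hu.ofReal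
  filter_upwards [fourierInv_fourier_ae_eq huC hFi] with x hx
  refine hx.trans ?_
  rw [Real.fourierInv_eq', hF]
  have := Measure.integral_comp_mul_left
    (fun t : ℝ => Complex.exp (Complex.I * x * t) * ft u (-t)) (2 * Real.pi)
  rw [Complex.real_smul.symm.trans (by rw [one_div, ← abs_of_pos (a := (2 * Real.pi)⁻¹)
    (by positivity)]), ← this]
  congr 1 with t
  rw [smul_eq_mul]
  congr 2
  · simp only [RCLike.inner_apply, conj_trivial]
    push_cast
    ring_nf
  · ring_nf

/-- **Parseval's formula** for an integrable function with integrable transform. -/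
theorem integral_mul_eq_integral_ft {u g : ℝ → ℝ} (hu : Integrable u) (hu' : Integrable (ft u))
    (hg : Integrable g) :
    ((∫ x, u x * g x : ℝ) : ℂ) = (1 / (2 * Real.pi) : ℝ) * ∫ t, ft u (-t) * ft g t := by
  -- Fubini hypothesis for inserting the inversion formula of `u` under the integral against `g`.
  have hprod : Integrable (Function.uncurry fun (x t : ℝ) =>
      Complex.exp (Complex.I * x * t) * ((g x : ℂ) * ft u (-t))) (volume.prod volume) := by
    have h1 : Integrable (fun p : ℝ × ℝ => (g p.1 : ℂ) * ft u (-p.2)) (volume.prod volume) :=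
      hg.ofReal.mul_prod hu'.comp_neg
    refine h1.mono ?_ ?_
    · exact (Continuous.aestronglyMeasurable (by fun_prop)).mul h1.aestronglyMeasurable
    · exact Filter.Eventually.of_forall fun p => by
        simp [Function.uncurry, norm_cexp_I_mul]
  calc ((∫ x, u x * g x : ℝ) : ℂ) = ∫ x : ℝ, (g x : ℂ) * (u x : ℂ) := by
        rw [← integral_complex_ofReal]; congr 1 with x; push_cast; ring
    _ = ∫ x : ℝ, ((1 / (2 * Real.pi) : ℝ) : ℂ) *
          ∫ t : ℝ, Complex.exp (Complex.I * x * t) * ((g x : ℂ) * ft u (-t)) := by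
        refine integral_congr_ae ?_
        filter_upwards [ae_eq_integral_ft hu hu'] with x hx
        rw [hx, mul_left_comm, ← integral_const_mul]
        congr 2 with t
        ring
    _ = _ := by
        rw [integral_const_mul, integral_integral_swap hprod]
        congr 2 with t
        rw [mul_comm, show ft g t = ∫ x : ℝ, Complex.exp (Complex.I * t * x) * (g x : ℂ) from rfl,
          ← integral_mul_const]
        congr 1 with x
        rw [← mul_assoc, show Complex.I * (x : ℂ) * t = Complex.I * t * x by ring]


/-! ### Trigonometric kernels -/

/-- The trigonometric integral `(1/2π) Re ∫_A e^{itz} h(t) dt`. -/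
def trig (h : ℝ → ℂ) (A : Set ℝ) (z : ℝ) : ℝ :=
  (1 / (2 * Real.pi)) * (∫ t in A, Complex.exp (Complex.I * t * z) * h t).re

lemma continuous_trig {h : ℝ → ℂ} {A : Set ℝ} (hh : IntegrableOn h A) :
    Continuous (trig h A) := by
  refine continuous_const.mul (Complex.continuous_re.comp ?_)
  refine continuous_of_dominated (bound := fun t => ‖h t‖) ?_ ?_ hh.norm ?_
  · intro x
    exact (Continuous.aestronglyMeasurable (by fun_prop)).mul hh.aestronglyMeasurable
  · intro x
    exact Filter.Eventually.of_forall fun t => by simp [norm_cexp_I_mul]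
  · exact Filter.Eventually.of_forall fun t => by fun_prop

lemma abs_trig_le (h : ℝ → ℂ) (A : Set ℝ) (z : ℝ) :
    |trig h A z| ≤ (1 / (2 * Real.pi)) * ∫ t in A, ‖h t‖ := by
  rw [trig, abs_mul, abs_of_pos (a := 1 / (2 * Real.pi)) (by positivity)]
  gcongr
  refine (Complex.abs_re_le_norm _).trans ((norm_integral_le_integral_norm _).trans_eq ?_)
  simp [norm_cexp_I_mul]

section Noise

variable {ν : Measure ℝ} [IsProbabilityMeasure ν] {φ : ℝ → ℂ} {h : ℝ → ℂ} {A : Set ℝ}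

/-- Domination by `|h|`, integrable because the noise law is finite; this licenses exchanging the
noise and frequency integrals. -/
lemma integrable_cexp_mul (hh : IntegrableOn h A) (x : ℝ) :
    Integrable (fun p : ℝ × ℝ => Complex.exp (Complex.I * p.2 * (x + p.1 : ℝ)) * h p.2)
      (ν.prod (volume.restrict A)) := by
  have h1 : Integrable (fun p : ℝ × ℝ => (1 : ℂ) * h p.2) (ν.prod (volume.restrict A)) :=
    (integrable_const (1 : ℂ)).mul_prod hh
  refine h1.mono ?_ ?_
  · refine (Continuous.aestronglyMeasurable (by fun_prop)).mul ?_
    simpa using h1.aestronglyMeasurable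
  · exact Filter.Eventually.of_forall fun p => by simp only [norm_mul, norm_cexp_I_mul]; simp

/-- Averaging a trigonometric integral over the noise multiplies the integrand by the
characteristic function of the noise. -/
lemma integral_trig_add (hφ : ∀ t : ℝ, ∫ e, Complex.exp (Complex.I * t * e) ∂ν = φ t)
    (hh : IntegrableOn h A) (x : ℝ) :
    ∫ e, trig h A (x + e) ∂ν = trig (fun t => h t * φ t) A x := by
  have hi := integrable_cexp_mul (ν := ν) hh x
  unfold trig
  rw [integral_const_mul]
  congr 1
  have h1 : Integrable (fun e : ℝ =>
      ∫ t in A, Complex.exp (Complex.I * t * (x + e : ℝ)) * h t) ν := hi.integral_prod_left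
  have h2 := integral_re h1
  simp only [RCLike.re_eq_complex_re] at h2
  rw [h2, integral_integral_swap hi]
  congr 2 with t
  rw [show (fun t => h t * φ t) t = h t * φ t from rfl, ← hφ t, ← integral_const_mul,
    ← integral_const_mul]
  congr 1 with e
  push_cast
  rw [mul_add, Complex.exp_add]
  ring

/-- Second moment of a trigonometric integral of a noisy variable, through the total mass of the
characteristic function of the noise. -/
lemma lintegral_trig_add_sq_le (hφ : ∀ t : ℝ, ∫ e, Complex.exp (Complex.I * t * e) ∂ν = φ t)
    (hφm : Measurable φ) (hhm : Measurable h) (hh : IntegrableOn h A) (x : ℝ) :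
    ∫⁻ e, ‖∫ t in A, Complex.exp (Complex.I * t * (x + e : ℝ)) * h t‖ₑ ^ 2 ∂ν
      ≤ (∫⁻ t, ‖φ t‖ₑ) * ∫⁻ t in A, ‖h t‖ₑ ^ 2 := by
  set lam := volume.restrict A with hlam
  set G : ℝ → ℂ := fun e => ∫ t, Complex.exp (Complex.I * t * (x + e : ℝ)) * h t ∂lam with hG
  -- `Q` is the integrand of `G` times its conjugate at two frequencies. Averaging over the noise
  -- turns the product of exponentials into `φ (s - t)`.
  set Q : ℝ × (ℝ × ℝ) → ℂ := fun p =>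
    (Complex.exp (Complex.I * p.2.1 * (x + p.1 : ℝ)) * h p.2.1) *
      (starRingEnd ℂ) (Complex.exp (Complex.I * p.2.2 * (x + p.1 : ℝ)) * h p.2.2) with hQ
  have hQi : Integrable Q (ν.prod (lam.prod lam)) := by
    have h1 : Integrable (fun p : ℝ × (ℝ × ℝ) => (1 : ℂ) * (h p.2.1 * h p.2.2))
        (ν.prod (lam.prod lam)) :=
      (integrable_const (1 : ℂ)).mul_prod (hh.mul_prod hh)
    refine h1.mono (Measurable.aestronglyMeasurable ?_) ?_
    · refine Measurable.mul (Measurable.mul ?_ (by fun_prop))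
        (Complex.continuous_conj.measurable.comp (Measurable.mul ?_ (by fun_prop)))
      · exact Continuous.measurable (by fun_prop)
      · exact Continuous.measurable (by fun_prop)
    · exact Filter.Eventually.of_forall fun p => by
        simp only [hQ, norm_mul, RCLike.norm_conj, norm_cexp_I_mul]; simp
  have hGG : ∀ e, ∫ q, Q (e, q) ∂(lam.prod lam) = ((‖G e‖ ^ 2 : ℝ) : ℂ) := by
    intro e
    have := integral_prod_mul (μ := lam) (ν := lam)
      (fun s : ℝ => Complex.exp (Complex.I * s * (x + e : ℝ)) * h s)
      (fun t : ℝ => (starRingEnd ℂ) (Complex.exp (Complex.I * t * (x + e : ℝ)) * h t))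
    simp only [hQ]
    rw [this, integral_conj, Complex.mul_conj, Complex.normSq_eq_norm_sq]
  have hGi : Integrable (fun e => ‖G e‖ ^ 2) ν := by
    have h2 := hQi.integral_prod_left
    have h3 : Integrable (fun e => ((‖G e‖ ^ 2 : ℝ) : ℂ)) ν := by
      simpa only [hGG] using h2
    exact h3.re
  have hswap : ((∫ e, ‖G e‖ ^ 2 ∂ν : ℝ) : ℂ) = ∫ q : ℝ × ℝ,
      Complex.exp (Complex.I * (q.1 - q.2 : ℝ) * x) * φ (q.1 - q.2) *
        (h q.1 * (starRingEnd ℂ) (h q.2)) ∂(lam.prod lam) := by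
    rw [← integral_complex_ofReal]
    simp only [← hGG]
    rw [integral_integral_swap (f := fun e q => Q (e, q)) hQi]
    congr 1 with q
    rw [← hφ, ← integral_const_mul, ← integral_mul_const]
    congr 1 with e
    simp only [hQ]
    rw [map_mul, ← Complex.exp_conj, mul_mul_mul_comm, ← Complex.exp_add, ← Complex.exp_add]
    congr 2
    simp
    ring
  have hC : ∀ s : ℝ, ∫⁻ t, ‖φ (s - t)‖ₑ = ∫⁻ t, ‖φ t‖ₑ := fun s =>
    lintegral_sub_left_eq_self (fun t => ‖φ t‖ₑ) s
  have hC' : ∀ s : ℝ, ∫⁻ t, ‖φ (t - s)‖ₑ = ∫⁻ t, ‖φ t‖ₑ := fun s =>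
    lintegral_sub_right_eq_self (fun t => ‖φ t‖ₑ) s
  have hle : ∫⁻ e, ‖G e‖ₑ ^ 2 ∂ν ≤ ∫⁻ s, ∫⁻ t, ‖φ (s - t)‖ₑ * (‖h s‖ₑ * ‖h t‖ₑ) ∂lam ∂lam := by
    have e1 : ∫⁻ e, ‖G e‖ₑ ^ 2 ∂ν = ‖((∫ e, ‖G e‖ ^ 2 ∂ν : ℝ) : ℂ)‖ₑ := by
      have h0 : 0 ≤ ∫ e, ‖G e‖ ^ 2 ∂ν := integral_nonneg fun e => by positivity
      rw [← ofReal_norm, Complex.norm_real, Real.norm_of_nonneg h0,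
        ofReal_integral_eq_lintegral_ofReal hGi (Filter.Eventually.of_forall fun e => by positivity)]
      congr 1 with e
      rw [ENNReal.ofReal_pow (norm_nonneg _), ofReal_norm]
    rw [e1, hswap]
    refine (enorm_integral_le_lintegral_enorm _).trans_eq ?_
    have e2 : ∀ q : ℝ × ℝ, ‖Complex.exp (Complex.I * (q.1 - q.2 : ℝ) * x) * φ (q.1 - q.2) *
        (h q.1 * (starRingEnd ℂ) (h q.2))‖ₑ = ‖φ (q.1 - q.2)‖ₑ * (‖h q.1‖ₑ * ‖h q.2‖ₑ) := by
      intro q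
      simp only [enorm_mul, RCLike.enorm_conj]
      rw [← ofReal_norm (Complex.exp _), norm_cexp_I_mul]
      simp
    simp only [e2]
    rw [lintegral_prod _ (by fun_prop)]
  refine hle.trans ?_
  -- Schur's test: `2 |h(s)| |h(t)| ≤ |h(s)|² + |h(t)|²`, after which translation invariance
  -- integrates out the other frequency and leaves the total mass of `φ`.
  have hamgm : ∀ a b : ENNReal, 2 * (a * b) ≤ a ^ 2 + b ^ 2 := by
    intro a b
    induction a with
    | top => simp
    | coe a =>
      induction b with
      | top => simp
      | coe b =>
        norm_cast
        have := two_mul_le_add_sq a b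
        linarith [mul_assoc 2 a b]
  have h2 : 2 * ∫⁻ s, ∫⁻ t, ‖φ (s - t)‖ₑ * (‖h s‖ₑ * ‖h t‖ₑ) ∂lam ∂lam
      ≤ 2 * ((∫⁻ t, ‖φ t‖ₑ) * ∫⁻ t, ‖h t‖ₑ ^ 2 ∂lam) := by
    calc 2 * ∫⁻ s, ∫⁻ t, ‖φ (s - t)‖ₑ * (‖h s‖ₑ * ‖h t‖ₑ) ∂lam ∂lam
        = ∫⁻ s, ∫⁻ t, 2 * (‖φ (s - t)‖ₑ * (‖h s‖ₑ * ‖h t‖ₑ)) ∂lam ∂lam := by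
          rw [← lintegral_const_mul' _ _ (by simp)]
          congr 1 with s
          rw [← lintegral_const_mul' _ _ (by simp)]
      _ ≤ ∫⁻ s, ∫⁻ t, (‖φ (s - t)‖ₑ * ‖h s‖ₑ ^ 2 + ‖φ (s - t)‖ₑ * ‖h t‖ₑ ^ 2) ∂lam ∂lam := by
          refine lintegral_mono fun s => lintegral_mono fun t => ?_
          rw [← mul_add, mul_left_comm]
          gcongr
          exact hamgm _ _
      _ = (∫⁻ s, ∫⁻ t, ‖φ (s - t)‖ₑ * ‖h s‖ₑ ^ 2 ∂lam ∂lam)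
          + ∫⁻ t, ∫⁻ s, ‖φ (s - t)‖ₑ * ‖h t‖ₑ ^ 2 ∂lam ∂lam := by
          rw [lintegral_lintegral_swap (f := fun t s => ‖φ (s - t)‖ₑ * ‖h t‖ₑ ^ 2)
            (by fun_prop), ← lintegral_add_left (by fun_prop)]
          congr 1 with s
          rw [lintegral_add_left (by fun_prop)]
      _ ≤ (∫⁻ s, (∫⁻ t, ‖φ t‖ₑ) * ‖h s‖ₑ ^ 2 ∂lam)
          + ∫⁻ t, (∫⁻ t, ‖φ t‖ₑ) * ‖h t‖ₑ ^ 2 ∂lam := by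
          refine add_le_add (lintegral_mono fun s => ?_) (lintegral_mono fun t => ?_)
          · rw [lintegral_mul_const _ (by fun_prop)]
            exact mul_le_mul_left ((setLIntegral_le_lintegral _ _).trans_eq (hC s)) _
          · rw [lintegral_mul_const _ (by fun_prop)]
            exact mul_le_mul_left ((setLIntegral_le_lintegral _ _).trans_eq (hC' t)) _
      _ = _ := by
          rw [lintegral_const_mul _ (by fun_prop), two_mul]
  exact (ENNReal.mul_le_mul_iff_right (by simp) (by simp)).1 h2

/-- Variance bound for a trigonometric integral of a noisy variable. -/
lemma integral_trig_add_sq_le (hφ : ∀ t : ℝ, ∫ e, Complex.exp (Complex.I * t * e) ∂ν = φ t)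
    (hφm : Measurable φ) (hhm : Measurable h) (hh : IntegrableOn h A) (x : ℝ) :
    ∫ e, trig h A (x + e) ^ 2 ∂ν ≤ (1 / (2 * Real.pi)) ^ 2 *
      (min ((∫⁻ t, ‖φ t‖ₑ) * ∫⁻ t in A, ‖h t‖ₑ ^ 2) ((∫⁻ t in A, ‖h t‖ₑ) ^ 2)).toReal := by
  set G : ℝ → ℂ := fun e => ∫ t in A, Complex.exp (Complex.I * t * (x + e : ℝ)) * h t with hG
  have hfin : (∫⁻ t in A, ‖h t‖ₑ) ^ 2 ≠ ⊤ := ENNReal.pow_ne_top hh.2.ne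
  have hGle : ∀ e, ‖G e‖ₑ ≤ ∫⁻ t in A, ‖h t‖ₑ := by
    intro e
    refine (enorm_integral_le_lintegral_enorm _).trans_eq ?_
    congr 1 with t
    rw [enorm_mul, ← ofReal_norm (Complex.exp _), norm_cexp_I_mul]
    simp
  have hlint : ∫⁻ e, ‖G e‖ₑ ^ 2 ∂ν
      ≤ min ((∫⁻ t, ‖φ t‖ₑ) * ∫⁻ t in A, ‖h t‖ₑ ^ 2) ((∫⁻ t in A, ‖h t‖ₑ) ^ 2) := by
    refine le_min (lintegral_trig_add_sq_le hφ hφm hhm hh x) ?_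
    calc ∫⁻ e, ‖G e‖ₑ ^ 2 ∂ν ≤ ∫⁻ _, (∫⁻ t in A, ‖h t‖ₑ) ^ 2 ∂ν :=
          lintegral_mono fun e => by gcongr; exact hGle e
      _ = _ := by simp
  have htrig : ∀ e, trig h A (x + e) ^ 2 = (1 / (2 * Real.pi)) ^ 2 * (G e).re ^ 2 := by
    intro e; rw [trig, mul_pow]
  simp only [htrig]
  rw [integral_const_mul]
  gcongr
  have hGc : Continuous fun e => (G e).re ^ 2 := by
    have h1 : Continuous fun e => trig h A (x + e) ^ 2 :=
      ((continuous_trig hh).comp (by fun_prop)).pow 2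
    have h2 : (fun e => (G e).re ^ 2) = fun e => (2 * Real.pi) ^ 2 * trig h A (x + e) ^ 2 := by
      ext e
      rw [htrig]
      field_simp
    rw [h2]
    exact continuous_const.mul h1
  rw [integral_eq_lintegral_of_nonneg_ae (Filter.Eventually.of_forall fun e => by positivity)
    hGc.aestronglyMeasurable]
  refine ENNReal.toReal_mono (ne_top_of_le_ne_top hfin (min_le_right _ _)) (le_trans ?_ hlint)
  refine lintegral_mono fun e => ?_
  rw [ENNReal.ofReal_le_iff_le_toReal (by simp), ENNReal.toReal_pow, toReal_enorm, ← sq_abs]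
  gcongr
  exact Complex.abs_re_le_norm _

end Noise


/-! ### Sums of conditionally centred variables -/

/-- Every noise variable is independent of the current state and of the past. -/
def NoiseIndep {Ω : Type*} [MeasurableSpace Ω] (μ : Measure Ω) (X ε : ℕ → Ω → ℝ) : Prop :=
  ∀ i : ℕ, IndepFun (ε i) (fun ω => (X i ω, fun j : Fin i => (X j ω, ε j ω))) μ

/-- A measurable bounded function of state and noise, centred in the noise, with second moment
at most `v`. -/
structure CentredNoise (ν : Measure ℝ) (D : ℝ → ℝ → ℝ) (b v : ℝ) : Prop where
  measurable : Measurable (Function.uncurry D)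
  bound : ∀ x e, |D x e| ≤ b
  centred : ∀ x, ∫ e, D x e ∂ν = 0
  second : ∀ x, ∫ e, D x e ^ 2 ∂ν ≤ v

section

set_option linter.unusedSectionVars false

variable {Ω : Type*} [MeasurableSpace Ω] {μ : Measure Ω} [IsProbabilityMeasure μ]
  {X ε : ℕ → Ω → ℝ} {ν : Measure ℝ} [IsProbabilityMeasure ν] {D : ℝ → ℝ → ℝ} {b v : ℝ}

lemma exp_le_one_add_add_sq {y : ℝ} (hy : |y| ≤ 1) : Real.exp y ≤ 1 + y + y ^ 2 := by
  have := (abs_le.1 (Real.abs_exp_sub_one_sub_id_le hy)).2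
  linarith

/-- One step of the Laplace bound: on `[-1, 1]` the exponential is at most `1 + y + y²`, and
centring removes the linear term. The bound is uniform in the state, so it can be iterated. -/
lemma CentredNoise.lintegral_exp_le (hD : CentredNoise ν D b v) {l : ℝ} (hl : |l| * b ≤ 1)
    (x : ℝ) :
    ∫⁻ e, ENNReal.ofReal (Real.exp (l * D x e)) ∂ν ≤ ENNReal.ofReal (Real.exp (l ^ 2 * v)) := by
  have hm : Measurable (D x) := hD.measurable.comp measurable_prodMk_left
  have hle : ∀ e, |l * D x e| ≤ 1 := fun e => by
    rw [abs_mul]; exact (mul_le_mul_of_nonneg_left (hD.bound x e) (abs_nonneg l)).trans hl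
  have hi : Integrable (fun e => D x e) ν :=
    Integrable.of_bound hm.aestronglyMeasurable b (Filter.Eventually.of_forall (hD.bound x))
  have hi1 : Integrable (fun e => 1 + l * D x e) ν := (integrable_const 1).add (hi.const_mul l)
  have hi2 : Integrable (fun e => D x e ^ 2) ν := by
    refine Integrable.of_bound (hm.pow_const 2).aestronglyMeasurable (b ^ 2)
      (Filter.Eventually.of_forall fun e => ?_)
    rw [norm_pow]
    exact pow_le_pow_left₀ (norm_nonneg _) (hD.bound x e) 2
  have hie : Integrable (fun e => Real.exp (l * D x e)) ν := by
    refine Integrable.of_bound (by fun_prop) (Real.exp 1) (Filter.Eventually.of_forall fun e => ?_)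
    rw [Real.norm_of_nonneg (Real.exp_pos _).le]
    exact Real.exp_le_exp.2 (le_of_abs_le (hle e))
  rw [← ofReal_integral_eq_lintegral_ofReal hie
    (Filter.Eventually.of_forall fun e => (Real.exp_pos _).le)]
  refine ENNReal.ofReal_le_ofReal ?_
  calc ∫ e, Real.exp (l * D x e) ∂ν ≤ ∫ e, (1 + l * D x e + l ^ 2 * D x e ^ 2) ∂ν := by
        refine integral_mono hie (hi1.add (hi2.const_mul (l ^ 2))) fun e => ?_
        have := exp_le_one_add_add_sq (hle e)
        rw [mul_pow] at this
        exact this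
    _ = 1 + l ^ 2 * ∫ e, D x e ^ 2 ∂ν := by
        rw [integral_add hi1 (hi2.const_mul (l ^ 2)),
          integral_add (integrable_const 1) (hi.const_mul l), integral_const_mul,
          integral_const_mul, hD.centred x]
        simp
    _ ≤ 1 + l ^ 2 * v := by gcongr; exact hD.second x
    _ ≤ Real.exp (l ^ 2 * v) := by linarith [Real.add_one_le_exp (l ^ 2 * v)]

/-- Exponential moments of a sum of centred functions of state and noise. -/
lemma CentredNoise.lintegral_exp_sum_le (hD : CentredNoise ν D b v)
    (hX : ∀ i, Measurable (X i)) (hε : ∀ i, Measurable (ε i)) (hind : NoiseIndep μ X ε)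
    (hν : ∀ i, μ.map (ε i) = ν) {l : ℝ} (hl : |l| * b ≤ 1) (n : ℕ) :
    ∫⁻ ω, ENNReal.ofReal (Real.exp (l * ∑ k ∈ Finset.Icc 1 n, D (X k ω) (ε k ω))) ∂μ
      ≤ ENNReal.ofReal (Real.exp (n * (l ^ 2 * v))) := by
  induction n with
  | zero => simp
  | succ n ih =>
    -- Current state together with the past, indices `0` to `n`. The sums start at `1`, hence the
    -- filter on `1 ≤ k` in `F`.
    set U : Ω → ℝ × (Fin (n + 1) → ℝ × ℝ) :=
      fun ω => (X (n + 1) ω, fun j : Fin (n + 1) => (X j ω, ε j ω)) with hU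
    have hUm : Measurable U := by
      refine (hX _).prodMk (measurable_pi_lambda _ fun j => (hX _).prodMk (hε _))
    set F : ℝ × (Fin (n + 1) → ℝ × ℝ) → ℝ := fun u =>
      ∑ k : Fin (n + 1), if 1 ≤ (k : ℕ) then D (u.2 k).1 (u.2 k).2 else 0 with hF
    have hFm : Measurable F := by
      refine Finset.measurable_sum _ fun k _ => ?_
      split_ifs
      · exact hD.measurable.comp ((measurable_pi_apply k).comp measurable_snd)
      · exact measurable_const
    have hFU : ∀ ω, F (U ω) = ∑ k ∈ Finset.Icc 1 n, D (X k ω) (ε k ω) := by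
      intro ω
      simp only [hF, hU]
      rw [Fin.sum_univ_eq_sum_range (fun k => if 1 ≤ k then D (X k ω) (ε k ω) else 0) (n + 1),
        ← Finset.sum_filter]
      refine Finset.sum_congr ?_ fun _ _ => rfl
      ext k
      simp only [Finset.mem_filter, Finset.mem_range, Finset.mem_Icc]
      omega
    set Φ : ℝ × (ℝ × (Fin (n + 1) → ℝ × ℝ)) → ENNReal := fun p =>
      ENNReal.ofReal (Real.exp (l * F p.2)) * ENNReal.ofReal (Real.exp (l * D p.2.1 p.1)) with hΦ
    have hΦm : Measurable Φ := by
      have h1 : Measurable fun p : ℝ × (ℝ × (Fin (n + 1) → ℝ × ℝ)) => D p.2.1 p.1 :=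
        hD.measurable.comp ((measurable_fst.comp measurable_snd).prodMk measurable_fst)
      have h2 : Measurable fun p : ℝ × (ℝ × (Fin (n + 1) → ℝ × ℝ)) => F p.2 :=
        hFm.comp measurable_snd
      exact (h2.const_mul l).exp.ennreal_ofReal.mul (h1.const_mul l).exp.ennreal_ofReal
    -- The new noise variable is independent of everything else in the exponential, so it can be
    -- integrated out first.
    have hlaw : μ.map (fun ω => (ε (n + 1) ω, U ω)) = ν.prod (μ.map U) := by
      rw [(indepFun_iff_map_prod_eq_prod_map_map (hε _).aemeasurable hUm.aemeasurable).1
        (hind (n + 1)), hν]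
    have : IsProbabilityMeasure (μ.map U) := Measure.isProbabilityMeasure_map hUm.aemeasurable
    calc ∫⁻ ω, ENNReal.ofReal (Real.exp (l * ∑ k ∈ Finset.Icc 1 (n + 1), D (X k ω) (ε k ω))) ∂μ
        = ∫⁻ ω, Φ (ε (n + 1) ω, U ω) ∂μ := by
          congr 1 with ω
          simp only [hΦ]
          rw [← ENNReal.ofReal_mul (Real.exp_pos _).le, ← Real.exp_add, hFU,
            Finset.sum_Icc_succ_top (by omega), mul_add]
      _ = ∫⁻ p, Φ p ∂(ν.prod (μ.map U)) := by
          rw [← hlaw, lintegral_map hΦm ((hε _).prodMk hUm)]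
      _ = ∫⁻ u, ∫⁻ e, Φ (e, u) ∂ν ∂(μ.map U) := lintegral_prod_symm' _ hΦm
      _ ≤ ∫⁻ u, ENNReal.ofReal (Real.exp (l * F u)) * ENNReal.ofReal (Real.exp (l ^ 2 * v))
            ∂(μ.map U) := by
          refine lintegral_mono fun u => ?_
          simp only [hΦ]
          rw [lintegral_const_mul']
          · gcongr
            exact hD.lintegral_exp_le hl u.1
          · exact ENNReal.ofReal_ne_top
      _ = (∫⁻ ω, ENNReal.ofReal (Real.exp (l * F (U ω))) ∂μ)
            * ENNReal.ofReal (Real.exp (l ^ 2 * v)) := by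
          rw [lintegral_mul_const' _ _ ENNReal.ofReal_ne_top, lintegral_map (by fun_prop) hUm]
      _ ≤ ENNReal.ofReal (Real.exp (n * (l ^ 2 * v))) * ENNReal.ofReal (Real.exp (l ^ 2 * v)) := by
          simp only [hFU]
          gcongr
      _ = _ := by
          rw [← ENNReal.ofReal_mul (Real.exp_pos _).le, ← Real.exp_add]
          congr 2
          push_cast
          ring

lemma CentredNoise.measurable_sum (hD : CentredNoise ν D b v)
    (hX : ∀ i, Measurable (X i)) (hε : ∀ i, Measurable (ε i)) (n : ℕ) :
    Measurable fun ω => ∑ k ∈ Finset.Icc 1 n, D (X k ω) (ε k ω) :=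
  Finset.measurable_sum _ fun k _ => hD.measurable.comp ((hX k).prodMk (hε k))

lemma CentredNoise.abs_sum_le (hD : CentredNoise ν D b v) (n : ℕ) (ω : Ω) :
    |∑ k ∈ Finset.Icc 1 n, D (X k ω) (ε k ω)| ≤ n * b := by
  refine (Finset.abs_sum_le_sum_abs _ _).trans ((Finset.sum_le_card_nsmul _ _ b
    fun k _ => hD.bound _ _).trans_eq ?_)
  simp

lemma CentredNoise.integrable_exp (hD : CentredNoise ν D b v)
    (hX : ∀ i, Measurable (X i)) (hε : ∀ i, Measurable (ε i)) (l : ℝ) (n : ℕ) :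
    Integrable (fun ω => Real.exp (l * ∑ k ∈ Finset.Icc 1 n, D (X k ω) (ε k ω))) μ := by
  have hm := hD.measurable_sum hX hε n
  refine Integrable.of_bound (hm.const_mul l).exp.aestronglyMeasurable (Real.exp (|l| * (n * b)))
    (Filter.Eventually.of_forall fun ω => ?_)
  rw [Real.norm_of_nonneg (Real.exp_pos _).le]
  refine Real.exp_le_exp.2 ((le_abs_self _).trans ?_)
  rw [abs_mul]
  exact mul_le_mul_of_nonneg_left (hD.abs_sum_le n ω) (abs_nonneg l)

lemma CentredNoise.integral_exp_sum_le (hD : CentredNoise ν D b v)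
    (hX : ∀ i, Measurable (X i)) (hε : ∀ i, Measurable (ε i)) (hind : NoiseIndep μ X ε)
    (hν : ∀ i, μ.map (ε i) = ν) {l : ℝ} (hl : |l| * b ≤ 1) (n : ℕ) :
    ∫ ω, Real.exp (l * ∑ k ∈ Finset.Icc 1 n, D (X k ω) (ε k ω)) ∂μ
      ≤ Real.exp (n * (l ^ 2 * v)) := by
  rw [← ENNReal.ofReal_le_ofReal_iff (Real.exp_pos _).le, ofReal_integral_eq_lintegral_ofReal
    (hD.integrable_exp hX hε l n) (Filter.Eventually.of_forall fun e => (Real.exp_pos _).le)]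
  exact hD.lintegral_exp_sum_le hX hε hind hν hl n

lemma CentredNoise.integrable_sq (hD : CentredNoise ν D b v)
    (hX : ∀ i, Measurable (X i)) (hε : ∀ i, Measurable (ε i)) (n : ℕ) :
    Integrable (fun ω => (∑ k ∈ Finset.Icc 1 n, D (X k ω) (ε k ω)) ^ 2) μ := by
  refine Integrable.of_bound ((hD.measurable_sum hX hε n).pow_const 2).aestronglyMeasurable
    ((n * b) ^ 2) (Filter.Eventually.of_forall fun ω => ?_)
  rw [norm_pow]
  exact pow_le_pow_left₀ (norm_nonneg _) (hD.abs_sum_le n ω) 2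

lemma CentredNoise.b_nonneg (hD : CentredNoise ν D b v) : 0 ≤ b :=
  (abs_nonneg _).trans (hD.bound 0 0)

lemma CentredNoise.v_nonneg (hD : CentredNoise ν D b v) : 0 ≤ v :=
  (integral_nonneg fun _ => sq_nonneg _).trans (hD.second 0)

/-- Variance bound for a sum of centred functions of state and noise. -/
lemma CentredNoise.integral_sum_sq_le (hD : CentredNoise ν D b v)
    (hX : ∀ i, Measurable (X i)) (hε : ∀ i, Measurable (ε i)) (hind : NoiseIndep μ X ε)
    (hν : ∀ i, μ.map (ε i) = ν) (n : ℕ) :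
    ∫ ω, (∑ k ∈ Finset.Icc 1 n, D (X k ω) (ε k ω)) ^ 2 ∂μ ≤ 4 * (n * v) := by
  have hb := hD.b_nonneg
  have hv := hD.v_nonneg
  set S : Ω → ℝ := fun ω => ∑ k ∈ Finset.Icc 1 n, D (X k ω) (ε k ω) with hS
  -- Small enough that both `l b ≤ 1` and `n l² v ≤ 1`. The variance is read off the Laplace bounds
  -- at `±l`, and `l²` is divided out at the end.
  set l : ℝ := 1 / (1 + b + n * v) with hl
  have hden : 0 < 1 + b + n * v := by positivity
  have hl0 : 0 < l := by positivity
  have hl1 : l * b ≤ 1 := by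
    rw [hl, one_div, inv_mul_le_iff₀ hden]
    nlinarith [mul_nonneg (Nat.cast_nonneg (α := ℝ) n) hv]
  have hl2 : n * (l ^ 2 * v) ≤ 1 := by
    have h1 : l * (n * v) ≤ 1 := by
      rw [hl, one_div, inv_mul_le_iff₀ hden]; linarith
    have h2 : l ≤ 1 := by
      rw [hl, one_div, inv_le_one₀ hden]
      nlinarith [mul_nonneg (Nat.cast_nonneg (α := ℝ) n) hv]
    calc n * (l ^ 2 * v) = l * (l * (n * v)) := by ring
      _ ≤ 1 * 1 := by gcongr
      _ = 1 := one_mul 1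
  have hy0 : 0 ≤ n * (l ^ 2 * v) := by positivity
  have hexp : Real.exp (n * (l ^ 2 * v)) ≤ 1 + 2 * (n * (l ^ 2 * v)) := by
    have := exp_le_one_add_add_sq (y := n * (l ^ 2 * v)) (by rwa [abs_of_nonneg hy0])
    nlinarith
  -- This is `y² ≤ 2 (cosh y - 1)`. Each of the two exponential moments exceeds `1` by at most `2 n
  -- l² v`, whence the constant `4`.
  have hcosh : ∀ y : ℝ, y ^ 2 ≤ Real.exp y + Real.exp (-y) - 2 := by
    intro y
    have key : ∀ z : ℝ, 0 ≤ z → (2 * z) ^ 2 ≤ Real.exp (2 * z) + Real.exp (-(2 * z)) - 2 := by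
      intro z hz
      have h1 := Real.self_le_sinh_iff.2 hz
      rw [Real.sinh_eq] at h1
      have h2 : (2 * z) ^ 2 ≤ (Real.exp z - Real.exp (-z)) ^ 2 :=
        pow_le_pow_left₀ (by linarith) (by linarith) 2
      have h3 : Real.exp z * Real.exp (-z) = 1 := by rw [← Real.exp_add]; simp
      have h4 : Real.exp (2 * z) = Real.exp z ^ 2 := by rw [two_mul, Real.exp_add, sq]
      have h5 : Real.exp (-(2 * z)) = Real.exp (-z) ^ 2 := by
        rw [two_mul, neg_add, Real.exp_add, sq]
      rw [h4, h5]
      nlinarith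
    rcases le_total 0 y with h | h
    · have := key (y / 2) (by linarith)
      rwa [mul_div_cancel₀ y two_ne_zero] at this
    · have := key (-y / 2) (by linarith)
      rw [mul_div_cancel₀ (-y) two_ne_zero, neg_sq, neg_neg] at this
      linarith
  have hip := hD.integrable_exp (μ := μ) hX hε l n
  have hin := hD.integrable_exp (μ := μ) hX hε (-l) n
  have hep := hD.integral_exp_sum_le hX hε hind hν (l := l) (by rwa [abs_of_pos hl0]) n
  have hen := hD.integral_exp_sum_le hX hε hind hν (l := -l) (by rwa [abs_neg, abs_of_pos hl0]) n
  rw [neg_sq] at hen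
  have his : Integrable (fun ω => Real.exp (l * S ω) + Real.exp (-l * S ω)) μ := hip.add hin
  have key : l ^ 2 * ∫ ω, S ω ^ 2 ∂μ ≤ 4 * (n * (l ^ 2 * v)) := by
    rw [← integral_const_mul]
    calc ∫ ω, l ^ 2 * S ω ^ 2 ∂μ
        ≤ ∫ ω, (Real.exp (l * S ω) + Real.exp (-l * S ω) - 2) ∂μ := by
          refine integral_mono ((hD.integrable_sq hX hε n).const_mul _)
            (his.sub (integrable_const 2)) fun ω => ?_
          have := hcosh (l * S ω)
          rw [mul_pow, ← neg_mul] at this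
          exact this
      _ = (∫ ω, Real.exp (l * S ω) ∂μ) + (∫ ω, Real.exp (-l * S ω) ∂μ) - 2 := by
          rw [integral_sub his (integrable_const 2), integral_add hip hin]
          simp [hS]
      _ ≤ _ := by linarith
  have hlsq : 0 < l ^ 2 := by positivity
  refine le_of_mul_le_mul_left ?_ hlsq
  linarith

/-- Integrated Bernstein type deviation of a sum of centred functions of state and noise. -/
lemma CentredNoise.integral_max_sq_sub_le (hD : CentredNoise ν D b v)
    (hX : ∀ i, Measurable (X i)) (hε : ∀ i, Measurable (ε i)) (hind : NoiseIndep μ X ε)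
    (hν : ∀ i, μ.map (ε i) = ν) (n : ℕ) {x τ : ℝ} (hx : 1 ≤ x) (hτ : 0 < τ)
    (hτv : 25 * x * (n * v) ≤ τ ^ 2) (hτb : 2 * x * b ≤ τ) :
    ∫ ω, max ((∑ k ∈ Finset.Icc 1 n, D (X k ω) (ε k ω)) ^ 2 - τ ^ 2) 0 ∂μ
      ≤ 3 * (τ ^ 2 / x) * Real.exp (-(3 / 2) * x) := by
  have hx0 : 0 < x := by linarith
  set S : Ω → ℝ := fun ω => ∑ k ∈ Finset.Icc 1 n, D (X k ω) (ε k ω) with hS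
  -- Chosen so that `l τ = 2 x`; the Laplace bound costs at most `x / 2`, leaving the exponent
  -- `-(3/2) x`.
  set l : ℝ := 2 * x / τ with hl
  have hl0 : 0 < l := by positivity
  have hlb : l * b ≤ 1 := by
    rw [hl, div_mul_eq_mul_div, div_le_one hτ]; exact hτb
  have hlτ : l * τ = 2 * x := by rw [hl]; field_simp
  have hlv : n * (l ^ 2 * v) ≤ x / 2 := by
    have : n * (l ^ 2 * v) = 4 * x ^ 2 * (n * v) / τ ^ 2 := by rw [hl]; field_simp; ring
    rw [this, div_le_iff₀ (by positivity)]
    nlinarith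
  -- For `s > τ`, `s² - τ²` is a quadratic in `l (s - τ)` without constant term, so it is dominated
  -- by `K` times the exponential of `l (s - τ)`.
  set K : ℝ := 2 * τ / l + 2 / l ^ 2 with hK
  have hK0 : 0 < K := by positivity
  have hpt : ∀ s : ℝ, 0 ≤ s → max (s ^ 2 - τ ^ 2) 0 ≤ K * Real.exp (-(2 * x)) * Real.exp (l * s) := by
    intro s hs
    have hexp : Real.exp (-(2 * x)) * Real.exp (l * s) = Real.exp (l * (s - τ)) := by
      rw [← Real.exp_add]; congr 1; rw [← hlτ]; ring
    rw [mul_assoc, hexp]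
    refine max_le ?_ (by positivity)
    rcases le_or_gt s τ with h | h
    · have : s ^ 2 - τ ^ 2 ≤ 0 := by nlinarith
      exact this.trans (by positivity)
    · set u := s - τ with hu
      have hu0 : 0 ≤ l * u := mul_nonneg hl0.le (by linarith)
      have h2 := Real.quadratic_le_exp_of_nonneg hu0
      have e1 : l * u ≤ Real.exp (l * u) := by nlinarith
      have e2 : (l * u) ^ 2 ≤ 2 * Real.exp (l * u) := by nlinarith
      have : s ^ 2 - τ ^ 2 = 2 * τ / l * (l * u) + 1 / l ^ 2 * (l * u) ^ 2 := by
        rw [hu]; field_simp; ring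
      rw [this]
      calc 2 * τ / l * (l * u) + 1 / l ^ 2 * (l * u) ^ 2
          ≤ 2 * τ / l * Real.exp (l * u) + 1 / l ^ 2 * (2 * Real.exp (l * u)) := by gcongr
        _ = K * Real.exp (l * u) := by rw [hK]; ring
  have hpt' : ∀ s : ℝ, max (s ^ 2 - τ ^ 2) 0
      ≤ K * Real.exp (-(2 * x)) * (Real.exp (l * s) + Real.exp (-l * s)) := by
    intro s
    rcases le_total 0 s with h | h
    · refine (hpt s h).trans ?_
      gcongr
      exact le_add_of_nonneg_right (Real.exp_pos _).le
    · have := hpt (-s) (by linarith)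
      rw [neg_sq] at this
      refine this.trans ?_
      gcongr
      rw [mul_neg, ← neg_mul]
      exact le_add_of_nonneg_left (Real.exp_pos _).le
  have hip := hD.integrable_exp (μ := μ) hX hε l n
  have hin := hD.integrable_exp (μ := μ) hX hε (-l) n
  have hep := hD.integral_exp_sum_le hX hε hind hν (l := l) (by rwa [abs_of_pos hl0]) n
  have hen := hD.integral_exp_sum_le hX hε hind hν (l := -l) (by rwa [abs_neg, abs_of_pos hl0]) n
  rw [neg_sq] at hen
  have hexp : Real.exp (n * (l ^ 2 * v)) ≤ Real.exp (x / 2) := Real.exp_le_exp.2 hlv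
  have hKx : 2 * K ≤ 3 * (τ ^ 2 / x) := by
    have : K = τ ^ 2 / x + τ ^ 2 / x * (1 / (2 * x)) := by rw [hK, hl]; field_simp
    have h1 : 1 / (2 * x) ≤ 1 / 2 := by
      apply one_div_le_one_div_of_le <;> linarith
    have h2 : 0 ≤ τ ^ 2 / x := by positivity
    nlinarith
  calc ∫ ω, max (S ω ^ 2 - τ ^ 2) 0 ∂μ
      ≤ ∫ ω, K * Real.exp (-(2 * x)) * (Real.exp (l * S ω) + Real.exp (-l * S ω)) ∂μ := by
        refine integral_mono_of_nonneg (Filter.Eventually.of_forall fun ω => le_max_right _ _)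
          ((hip.add hin).const_mul _) (Filter.Eventually.of_forall fun ω => hpt' (S ω))
    _ = K * Real.exp (-(2 * x)) *
          ((∫ ω, Real.exp (l * S ω) ∂μ) + ∫ ω, Real.exp (-l * S ω) ∂μ) := by
        rw [integral_const_mul, integral_add hip hin]
    _ ≤ K * Real.exp (-(2 * x)) * (Real.exp (x / 2) + Real.exp (x / 2)) := by
        gcongr
        · exact hep.trans hexp
        · exact hen.trans hexp
    _ = 2 * K * (Real.exp (-(2 * x)) * Real.exp (x / 2)) := by ring
    _ = 2 * K * Real.exp (-(3 / 2) * x) := by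
        rw [← Real.exp_add]; congr 2; ring
    _ ≤ _ := by gcongr

end


/-! ### Densities -/

section Density

variable {f : ℝ → ℝ} {ν : Measure ℝ}

lemma IsDensityOf.integral_eq (hf : IsDensityOf f ν) (F : ℝ → ℂ) :
    ∫ x, F x ∂ν = ∫ x, F x * (f x : ℂ) := by
  rw [hf.law_eq, integral_withDensity_eq_integral_toReal_smul
    (hf.measurable.ennreal_ofReal) (Filter.Eventually.of_forall fun x => ENNReal.ofReal_lt_top)]
  congr 1 with x
  rw [ENNReal.toReal_ofReal (hf.nonneg x), Complex.real_smul, mul_comm]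

lemma IsDensityOf.integral_cexp (hf : IsDensityOf f ν) (t : ℝ) :
    ∫ e, Complex.exp (Complex.I * t * e) ∂ν = ft f t :=
  hf.integral_eq _

lemma IsDensityOf.integrable [IsFiniteMeasure ν] (hf : IsDensityOf f ν) : Integrable f := by
  refine ⟨hf.measurable.aestronglyMeasurable, ?_⟩
  rw [hasFiniteIntegral_iff_ofReal (Filter.Eventually.of_forall hf.nonneg)]
  have : ν Set.univ < ⊤ := measure_lt_top ν _
  rwa [hf.law_eq, withDensity_apply _ MeasurableSet.univ, Measure.restrict_univ] at this

end Density

/-! ### Independence of the noise in the first context -/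

/-- Independence of `Y` from the pair and of `A` from `B` make the three variables mutually
independent; it suffices to check this on boxes. -/
lemma indepFun_prodMk_of_indepFun {Ω α β γ : Type*} [MeasurableSpace Ω] [MeasurableSpace α]
    [MeasurableSpace β] [MeasurableSpace γ] {μ : Measure Ω} [IsProbabilityMeasure μ]
    {A : Ω → α} {B : Ω → β} {Y : Ω → γ} (hA : Measurable A) (hB : Measurable B) (hY : Measurable Y)
    (h : IndepFun Y (fun ω => (A ω, B ω)) μ) (hAB : IndepFun A B μ) :
    IndepFun A (fun ω => (Y ω, B ω)) μ := by
  have hYB : IndepFun Y B μ := h.comp measurable_id measurable_snd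
  rw [indepFun_iff_map_prod_eq_prod_map_map hA.aemeasurable (hY.prodMk hB).aemeasurable]
  have : IsProbabilityMeasure (μ.map A) := Measure.isProbabilityMeasure_map hA.aemeasurable
  have : IsProbabilityMeasure (μ.map fun ω => (Y ω, B ω)) :=
    Measure.isProbabilityMeasure_map (hY.prodMk hB).aemeasurable
  have : IsProbabilityMeasure (μ.map fun ω => (A ω, (Y ω, B ω))) :=
    Measure.isProbabilityMeasure_map (hA.prodMk (hY.prodMk hB)).aemeasurable
  refine Measure.ext_prod₃ fun {s t u} hs ht hu => ?_
  rw [Measure.map_apply (hA.prodMk (hY.prodMk hB)) (hs.prod (ht.prod hu)), Measure.prod_prod,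
    Measure.map_apply hA hs, Measure.map_apply (hY.prodMk hB) (ht.prod hu)]
  have e1 : (fun ω => (A ω, (Y ω, B ω))) ⁻¹' (s ×ˢ t ×ˢ u)
      = Y ⁻¹' t ∩ (fun ω => (A ω, B ω)) ⁻¹' (s ×ˢ u) := by
    ext ω
    simp only [Set.mem_preimage, Set.mem_prod, Set.mem_inter_iff]
    tauto
  have e2 : (fun ω => (A ω, B ω)) ⁻¹' (s ×ˢ u) = A ⁻¹' s ∩ B ⁻¹' u := rfl
  have e3 : (fun ω => (Y ω, B ω)) ⁻¹' (t ×ˢ u) = Y ⁻¹' t ∩ B ⁻¹' u := rfl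
  rw [e1, h.measure_inter_preimage_eq_mul _ _ ht (hs.prod hu), e2, e3,
    hAB.measure_inter_preimage_eq_mul _ _ hs hu, hYB.measure_inter_preimage_eq_mul _ _ ht hu]
  ring

section Contexts

variable {Ω : Type*} [MeasurableSpace Ω] {μ : Measure Ω} [IsProbabilityMeasure μ]
  {X ε : ℕ → Ω → ℝ} {f g : ℝ → ℝ} {c : ℝ}

/-- The noise `ε_i` is independent of the earlier noise, and the whole state sequence is independent
of both. Regrouping and discarding the future states gives the same structure as in the second
context. -/
lemma ContextD1.noiseIndep (hM : Model μ X ε f g) (h : ContextD1 μ X ε c) :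
    NoiseIndep μ X ε := by
  intro i
  have hXs : Measurable fun ω j => X j ω := measurable_pi_lambda _ hM.measurable_X
  have hB : Measurable fun ω (j : Fin i) => ε j ω := measurable_pi_lambda _ fun j => hM.measurable_ε j
  have hAB : IndepFun (ε i) (fun ω (j : Fin i) => ε j ω) μ := by
    have h1 := hM.indep_ε.indepFun_finset {i} (Finset.range i) (by simp) hM.measurable_ε
    exact h1.comp (φ := fun (p : ({i} : Finset ℕ) → ℝ) => p ⟨i, by simp⟩)
      (ψ := fun (p : (Finset.range i) → ℝ) => fun j : Fin i => p ⟨j, by simp⟩)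
      (measurable_pi_apply _) (measurable_pi_lambda _ fun j => measurable_pi_apply _)
  have h2 : IndepFun (fun ω j => X j ω) (fun ω => (ε i ω, fun j : Fin i => ε j ω)) μ :=
    h.indep.comp (φ := id) (ψ := fun p : ℕ → ℝ => (p i, fun j : Fin i => p j)) measurable_id
      ((measurable_pi_apply i).prodMk (measurable_pi_lambda _ fun j => measurable_pi_apply _))
  have h3 := indepFun_prodMk_of_indepFun (hM.measurable_ε i) hB hXs h2 hAB
  refine h3.comp (φ := id) (ψ := fun p : (ℕ → ℝ) × (Fin i → ℝ) =>
    (p.1 i, fun j : Fin i => (p.1 j, p.2 j))) measurable_id ?_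
  refine ((measurable_pi_apply i).comp measurable_fst).prodMk (measurable_pi_lambda _ fun j => ?_)
  exact ((measurable_pi_apply _).comp measurable_fst).prodMk
    ((measurable_pi_apply _).comp measurable_snd)

set_option linter.unusedSectionVars false in
lemma ContextD2.noiseIndep (h : ContextD2 μ X ε c) : NoiseIndep μ X ε := h.indep

end Contexts

/-! ### Covariance inequality under β-mixing -/

section Covariance

lemma abs_integral_le_of_abs_le {Ω : Type*} [MeasurableSpace Ω] {μ : Measure Ω}
    [IsProbabilityMeasure μ] {W : Ω → ℝ} {C : ℝ} (hW : ∀ ω, |W ω| ≤ C) : |∫ ω, W ω ∂μ| ≤ C := by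
  have := norm_integral_le_of_norm_le_const (μ := μ) (f := W) (C := C) (Filter.Eventually.of_forall hW)
  simpa using this

/-- Covariance of two finitely valued variables. -/
lemma abs_cov_fin_le {Ω : Type*} {m₁ m₂ : MeasurableSpace Ω} [m0 : MeasurableSpace Ω]
    {μ : Measure Ω} [IsProbabilityMeasure μ] (h₁ : m₁ ≤ m0) (h₂ : m₂ ≤ m0) {β : ℝ}
    (hβ0 : 0 ≤ β) (hβ : betaCoeff μ m₁ m₂ ≤ ENNReal.ofReal β) {p q : ℕ} {u : Ω → Fin p}
    {v : Ω → Fin q} (hu : Measurable[m₁] u) (hv : Measurable[m₂] v) {a : Fin p → ℝ}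
    {b : Fin q → ℝ} (ha : ∀ i, |a i| ≤ 1) (hb : ∀ j, |b j| ≤ 1) :
    |∫ ω, a (u ω) * b (v ω) ∂μ - (∫ ω, a (u ω) ∂μ) * ∫ ω, b (v ω) ∂μ| ≤ 2 * β := by
  have hu0 : ∀ i, MeasurableSet (u ⁻¹' {i}) := fun i => h₁ _ (hu (measurableSet_singleton i))
  have hv0 : ∀ j, MeasurableSet (v ⁻¹' {j}) := fun j => h₂ _ (hv (measurableSet_singleton j))
  have hind : ∀ {s : Set Ω}, MeasurableSet s → Integrable (s.indicator (1 : Ω → ℝ)) μ :=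
    fun hs => (integrable_const (1 : ℝ)).indicator hs
  have iu : ∫ ω, a (u ω) ∂μ = ∑ i, a i * μ.real (u ⁻¹' {i}) := by
    have : ∀ ω, a (u ω) = ∑ i, a i * (u ⁻¹' {i}).indicator 1 ω := by
      intro ω
      rw [Finset.sum_eq_single (u ω)]
      · simp
      · intro i _ hi; simp [Ne.symm hi]
      · simp
    simp only [this]
    rw [integral_finsetSum _ fun i _ => (hind (hu0 i)).const_mul (a i)]
    simp only [integral_const_mul, integral_indicator_one (hu0 _)]
  have iv : ∫ ω, b (v ω) ∂μ = ∑ j, b j * μ.real (v ⁻¹' {j}) := by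
    have : ∀ ω, b (v ω) = ∑ j, b j * (v ⁻¹' {j}).indicator 1 ω := by
      intro ω
      rw [Finset.sum_eq_single (v ω)]
      · simp
      · intro i _ hi; simp [Ne.symm hi]
      · simp
    simp only [this]
    rw [integral_finsetSum _ fun i _ => (hind (hv0 i)).const_mul (b i)]
    simp only [integral_const_mul, integral_indicator_one (hv0 _)]
  have iuv : ∫ ω, a (u ω) * b (v ω) ∂μ
      = ∑ i, ∑ j, a i * b j * μ.real (u ⁻¹' {i} ∩ v ⁻¹' {j}) := by
    have : ∀ ω, a (u ω) * b (v ω)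
        = ∑ i, ∑ j, a i * b j * (u ⁻¹' {i} ∩ v ⁻¹' {j}).indicator 1 ω := by
      intro ω
      rw [Finset.sum_eq_single (u ω), Finset.sum_eq_single (v ω)]
      · simp
      · intro i _ hi; simp [Ne.symm hi]
      · simp
      · intro i _ hi; simp [Ne.symm hi]
      · simp
    have hint : ∀ i j, Integrable
        (fun ω => a i * b j * (u ⁻¹' {i} ∩ v ⁻¹' {j}).indicator (1 : Ω → ℝ) ω) μ := fun i j =>
      (hind ((hu0 i).inter (hv0 j))).const_mul _
    simp only [this]
    rw [integral_finsetSum _ fun i _ => integrable_finsetSum _ fun j _ => hint i j]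
    refine Finset.sum_congr rfl fun i _ => ?_
    rw [integral_finsetSum _ fun j _ => hint i j]
    refine Finset.sum_congr rfl fun j _ => ?_
    rw [integral_const_mul, integral_indicator_one ((hu0 i).inter (hv0 j))]
  -- The level sets form admissible partitions. The factor `1/2` in the coefficient is the source of
  -- `2 * β` in the bound.
  have hsum : (1 / 2) * ∑ i : Fin p, ∑ j : Fin q,
      |μ.real (u ⁻¹' {i} ∩ v ⁻¹' {j}) - μ.real (u ⁻¹' {i}) * μ.real (v ⁻¹' {j})| ≤ β := by
    rw [← ENNReal.ofReal_le_ofReal_iff hβ0]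
    refine le_trans ?_ hβ
    unfold betaCoeff
    exact le_iSup_of_le p (le_iSup_of_le q (le_iSup_of_le u (le_iSup_of_le v
      (le_iSup_of_le hu (le_iSup_of_le hv le_rfl)))))
  rw [iuv, iu, iv, Finset.sum_mul_sum, ← Finset.sum_sub_distrib]
  simp only [← Finset.sum_sub_distrib]
  calc |∑ i, ∑ j, (a i * b j * μ.real (u ⁻¹' {i} ∩ v ⁻¹' {j})
        - a i * μ.real (u ⁻¹' {i}) * (b j * μ.real (v ⁻¹' {j})))|
      ≤ ∑ i, ∑ j, |μ.real (u ⁻¹' {i} ∩ v ⁻¹' {j}) - μ.real (u ⁻¹' {i}) * μ.real (v ⁻¹' {j})| := by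
        refine (Finset.abs_sum_le_sum_abs _ _).trans (Finset.sum_le_sum fun i _ =>
          (Finset.abs_sum_le_sum_abs _ _).trans (Finset.sum_le_sum fun j _ => ?_))
        rw [show a i * b j * μ.real (u ⁻¹' {i} ∩ v ⁻¹' {j})
          - a i * μ.real (u ⁻¹' {i}) * (b j * μ.real (v ⁻¹' {j})) = a i * b j *
          (μ.real (u ⁻¹' {i} ∩ v ⁻¹' {j}) - μ.real (u ⁻¹' {i}) * μ.real (v ⁻¹' {j})) by ring,
          abs_mul, abs_mul]
        refine mul_le_of_le_one_left (abs_nonneg _) ?_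
        exact mul_le_one₀ (ha i) (abs_nonneg _) (hb j)
    _ ≤ 2 * β := by linarith

/-- The grid discretisation of `[-1, 1]` with mesh `1 / N`. -/
def gridIndex (N : ℕ) (y : ℝ) : Fin (2 * N + 1) :=
  ⟨min ⌊N * (y + 1)⌋₊ (2 * N), by omega⟩

def gridValue (N : ℕ) (i : Fin (2 * N + 1)) : ℝ := (i : ℕ) / N - 1

lemma measurable_gridIndex (N : ℕ) : Measurable (gridIndex N) :=
  (measurable_of_countable (fun k : ℕ => (⟨min k (2 * N), by omega⟩ : Fin (2 * N + 1)))).comp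
    (Nat.measurable_floor.comp (by fun_prop))

lemma abs_gridValue_le {N : ℕ} (hN : 0 < N) (i : Fin (2 * N + 1)) : |gridValue N i| ≤ 1 := by
  have hN' : (0 : ℝ) < N := by exact_mod_cast hN
  have hi : ((i : ℕ) : ℝ) ≤ 2 * N := by exact_mod_cast Nat.lt_succ_iff.1 i.2
  have h2 : ((i : ℕ) : ℝ) / N ≤ 2 := by rw [div_le_iff₀ hN']; exact hi
  have h0 : 0 ≤ ((i : ℕ) : ℝ) / N := by positivity
  rw [gridValue, abs_le]
  constructor <;> linarith

lemma abs_sub_gridValue_le {N : ℕ} (hN : 0 < N) {y : ℝ} (hy : |y| ≤ 1) :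
    |y - gridValue N (gridIndex N y)| ≤ 1 / N := by
  have hN' : (0 : ℝ) < N := by exact_mod_cast hN
  obtain ⟨h1, h2⟩ := abs_le.1 hy
  have h0 : 0 ≤ N * (y + 1) := mul_nonneg hN'.le (by linarith)
  -- For `y ≤ 1` the truncation in `gridIndex` is inactive.
  have hle : ⌊N * (y + 1)⌋₊ ≤ 2 * N := by
    have : (⌊N * (y + 1)⌋₊ : ℝ) ≤ 2 * N := (Nat.floor_le h0).trans (by nlinarith)
    exact_mod_cast this
  have hval : gridValue N (gridIndex N y) = (⌊N * (y + 1)⌋₊ : ℝ) / N - 1 := by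
    simp only [gridValue, gridIndex, min_eq_left hle]
  have e1 := Nat.floor_le h0
  have e2 := Nat.lt_floor_add_one (N * (y + 1))
  rw [hval, show y - ((⌊N * (y + 1)⌋₊ : ℝ) / N - 1) = (N * (y + 1) - ⌊N * (y + 1)⌋₊) / N by
    field_simp; ring, abs_div, abs_of_pos hN']
  gcongr
  rw [abs_le]
  constructor <;> linarith

/-- Covariance inequality for bounded variables under β-mixing. -/
lemma abs_cov_le {Ω : Type*} {m₁ m₂ : MeasurableSpace Ω} [m0 : MeasurableSpace Ω]
    {μ : Measure Ω} [IsProbabilityMeasure μ] (h₁ : m₁ ≤ m0) (h₂ : m₂ ≤ m0) {β : ℝ}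
    (hβ0 : 0 ≤ β) (hβ : betaCoeff μ m₁ m₂ ≤ ENNReal.ofReal β) {U V : Ω → ℝ}
    (hU : Measurable[m₁] U) (hV : Measurable[m₂] V) (hU1 : ∀ ω, |U ω| ≤ 1)
    (hV1 : ∀ ω, |V ω| ≤ 1) :
    |∫ ω, U ω * V ω ∂μ - (∫ ω, U ω ∂μ) * ∫ ω, V ω ∂μ| ≤ 2 * β := by
  have hU0 : Measurable U := hU.mono h₁ le_rfl
  have hV0 : Measurable V := hV.mono h₂ le_rfl
  have hint : ∀ {W : Ω → ℝ}, Measurable W → (∀ ω, |W ω| ≤ 1) → Integrable W μ :=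
    fun hW hW1 => Integrable.of_bound hW.aestronglyMeasurable 1 (Filter.Eventually.of_forall hW1)
  -- Rounding both variables to the grid makes them finitely valued and changes the covariance by at
  -- most `4 / N`; then `N` tends to infinity.
  have key : ∀ N : ℕ, 0 < N →
      |∫ ω, U ω * V ω ∂μ - (∫ ω, U ω ∂μ) * ∫ ω, V ω ∂μ| ≤ 2 * β + 4 / N := by
    intro N hN
    set A : Ω → ℝ := fun ω => gridValue N (gridIndex N (U ω)) with hA
    set B : Ω → ℝ := fun ω => gridValue N (gridIndex N (V ω)) with hB
    have hgm : Measurable fun y => gridValue N (gridIndex N y) :=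
      (measurable_of_countable (gridValue N)).comp (measurable_gridIndex N)
    have hAm : Measurable A := hgm.comp hU0
    have hBm : Measurable B := hgm.comp hV0
    have hA1 : ∀ ω, |A ω| ≤ 1 := fun ω => abs_gridValue_le hN _
    have hB1 : ∀ ω, |B ω| ≤ 1 := fun ω => abs_gridValue_le hN _
    have hfin := abs_cov_fin_le (μ := μ) h₁ h₂ hβ0 hβ
      (u := fun ω => gridIndex N (U ω)) (v := fun ω => gridIndex N (V ω))
      ((measurable_gridIndex N).comp hU) ((measurable_gridIndex N).comp hV)
      (a := gridValue N) (b := gridValue N) (abs_gridValue_le hN) (abs_gridValue_le hN)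
    have hmulint : ∀ {W W' : Ω → ℝ}, Measurable W → Measurable W' → (∀ ω, |W ω| ≤ 1) →
        (∀ ω, |W' ω| ≤ 1) → Integrable (fun ω => W ω * W' ω) μ := fun hW hW' h h' =>
      hint (hW.mul hW') fun ω => by
        rw [abs_mul]; exact mul_le_one₀ (h ω) (abs_nonneg _) (h' ω)
    have hAb : |∫ ω, U ω ∂μ - ∫ ω, A ω ∂μ| ≤ 1 / N := by
      rw [← integral_sub (hint hU0 hU1) (hint hAm hA1)]
      exact abs_integral_le_of_abs_le fun ω => abs_sub_gridValue_le hN (hU1 ω)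
    have hBb : |∫ ω, V ω ∂μ - ∫ ω, B ω ∂μ| ≤ 1 / N := by
      rw [← integral_sub (hint hV0 hV1) (hint hBm hB1)]
      exact abs_integral_le_of_abs_le fun ω => abs_sub_gridValue_le hN (hV1 ω)
    have hdiff : ∀ {x y x' y' : ℝ}, |y| ≤ 1 → |x'| ≤ 1 → |x - x'| ≤ 1 / N → |y - y'| ≤ 1 / N →
        |x * y - x' * y'| ≤ 2 / N := by
      intro x y x' y' hy hx' h h'
      rw [show x * y - x' * y' = (x - x') * y + x' * (y - y') by ring]
      refine (abs_add_le _ _).trans ?_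
      rw [abs_mul, abs_mul]
      calc |x - x'| * |y| + |x'| * |y - y'| ≤ 1 / N * 1 + 1 * (1 / N) := by gcongr
        _ = 2 / N := by ring
    have hAB : |∫ ω, U ω * V ω ∂μ - ∫ ω, A ω * B ω ∂μ| ≤ 2 / N := by
      rw [← integral_sub (hmulint hU0 hV0 hU1 hV1) (hmulint hAm hBm hA1 hB1)]
      refine abs_integral_le_of_abs_le fun ω => ?_
      exact hdiff (hV1 ω) (hA1 ω) (abs_sub_gridValue_le hN (hU1 ω))
        (abs_sub_gridValue_le hN (hV1 ω))
    have hprod := hdiff (abs_integral_le_of_abs_le hV1) (abs_integral_le_of_abs_le hA1) hAb hBb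
    have hsum : (4 : ℝ) / N = 2 / N + 2 / N := by ring
    rw [hsum]
    rw [abs_le] at hprod hAB hfin ⊢
    constructor <;> linarith [hprod.1, hprod.2, hAB.1, hAB.2, hfin.1, hfin.2]
  refine le_of_forall_pos_le_add fun δ hδ => ?_
  obtain ⟨N, hN⟩ := exists_nat_gt (4 / δ)
  have hN0 : (0 : ℝ) < N := lt_trans (by positivity) hN
  refine (key N (by exact_mod_cast hN0)).trans ?_
  gcongr
  rw [div_le_iff₀ hN0]
  rw [div_lt_iff₀ hδ] at hN
  linarith

end Covariance


/-! ### The empirical characteristic function of a mixing sequence -/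

section Mixing

set_option linter.unusedSectionVars false

variable {Ω : Type*} [MeasurableSpace Ω] {μ : Measure Ω} [IsProbabilityMeasure μ]

/-- The mixing coefficient is used with the past cut at `i`: `ξ i` belongs to the past and `ξ (i +
k)` to the future. -/
lemma abs_cov_comp_le {E : Type*} [MeasurableSpace E] {ξ : ℕ → Ω → E} {c : ℝ}
    (hξ : ∀ i, Measurable (ξ i)) (h : GeomMixing μ ξ c) {p : E → ℝ} (hp : Measurable p)
    (hp1 : ∀ y, |p y| ≤ 1) (i k : ℕ) :
    |∫ ω, p (ξ i ω) * p (ξ (i + k) ω) ∂μ - (∫ ω, p (ξ i ω) ∂μ) * ∫ ω, p (ξ (i + k) ω) ∂μ|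
      ≤ 2 * Real.exp (-c * k) := by
  refine abs_cov_le
    (m₁ := ⨆ j : {j : ℕ // j ≤ i}, MeasurableSpace.comap (ξ j) inferInstance)
    (m₂ := ⨆ j : {j : ℕ // i + k ≤ j}, MeasurableSpace.comap (ξ j) inferInstance)
    (iSup_le fun j => (hξ j).comap_le) (iSup_le fun j => (hξ j).comap_le) (Real.exp_pos _).le
    ?_ ?_ ?_ (fun ω => hp1 _) fun ω => hp1 _
  · refine le_trans ?_ (h.beta_le k)
    exact le_iSup (fun l : ℕ => betaCoeff μ
      (⨆ j : {j : ℕ // j ≤ l}, MeasurableSpace.comap (ξ j) inferInstance)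
      (⨆ j : {j : ℕ // l + k ≤ j}, MeasurableSpace.comap (ξ j) inferInstance)) i
  · exact hp.comp ((comap_measurable (ξ i)).mono
      (le_iSup (fun j : {j : ℕ // j ≤ i} => MeasurableSpace.comap (ξ j) inferInstance)
        ⟨i, le_rfl⟩) le_rfl)
  · exact hp.comp ((comap_measurable (ξ (i + k))).mono
      (le_iSup (fun j : {j : ℕ // i + k ≤ j} => MeasurableSpace.comap (ξ j) inferInstance)
        ⟨i + k, le_rfl⟩) le_rfl)

/-- Covariances of bounded functions of the states decay geometrically. -/
def CovDecay (μ : Measure Ω) (X : ℕ → Ω → ℝ) (c : ℝ) : Prop :=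
  ∀ p : ℝ → ℝ, Measurable p → (∀ y, |p y| ≤ 1) → ∀ i k : ℕ,
    |∫ ω, p (X i ω) * p (X (i + k) ω) ∂μ - (∫ ω, p (X i ω) ∂μ) * ∫ ω, p (X (i + k) ω) ∂μ|
      ≤ 2 * Real.exp (-c * k)

variable {X ε : ℕ → Ω → ℝ} {f g : ℝ → ℝ} {c : ℝ}

lemma ContextD1.covDecay (hM : Model μ X ε f g) (h : ContextD1 μ X ε c) : CovDecay μ X c :=
  fun _ hp hp1 i k => abs_cov_comp_le hM.measurable_X h.mixing hp hp1 i k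

/-- A function of the state is a function of the mixing pair through its second coordinate. -/
lemma ContextD2.covDecay (hM : Model μ X ε f g) (h : ContextD2 μ X ε c) : CovDecay μ X c :=
  fun p hp hp1 i k => abs_cov_comp_le (p := fun y : ℝ × ℝ => p y.2)
    (fun i => ((hM.measurable_X i).add (hM.measurable_ε i)).prodMk (hM.measurable_X i))
    h.mixing (hp.comp measurable_snd) (fun y => hp1 y.2) i k

/-- On each side of `i` the distance to `i` is injective, so each side is bounded by a full
geometric series. -/
lemma sum_pow_dist_le {r : ℝ} (h0 : 0 ≤ r) (h1 : r < 1) (n i : ℕ) :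
    ∑ j ∈ Finset.Icc 1 n, r ^ (Nat.dist i j) ≤ 2 * (1 - r)⁻¹ := by
  have geom : ∀ (s : Finset ℕ) (e : ℕ → ℕ), Set.InjOn e s → ∑ j ∈ s, r ^ e j ≤ (1 - r)⁻¹ := by
    intro s e he
    rw [← Finset.sum_image (f := fun k => r ^ k) he, ← tsum_geometric_of_lt_one h0 h1]
    exact (summable_geometric_of_lt_one h0 h1).sum_le_tsum _ fun k _ => pow_nonneg h0 k
  rw [← Finset.sum_filter_add_sum_filter_not _ (fun j => j ≤ i), two_mul]
  refine add_le_add (geom _ _ ?_) (geom _ _ ?_) <;>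
  · intro a ha b hb hab
    simp only [Finset.coe_filter, Set.mem_ofPred_eq, Nat.dist] at ha hb hab
    omega

/-- Expanding the square gives a matrix of covariances whose row sums are bounded by geometric
series, so the variance grows only linearly in `n`. -/
lemma CovDecay.integral_sum_sq_le (h : CovDecay μ X c) (hX : ∀ i, Measurable (X i)) (hc : 0 < c)
    {p : ℝ → ℝ} (hp : Measurable p) (hp1 : ∀ y, |p y| ≤ 1) {m : ℝ}
    (hm : ∀ i, ∫ ω, p (X i ω) ∂μ = m) (n : ℕ) :
    ∫ ω, (∑ k ∈ Finset.Icc 1 n, (p (X k ω) - m)) ^ 2 ∂μ ≤ 4 * (1 - Real.exp (-c))⁻¹ * n := by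
  have hr1 : Real.exp (-c) < 1 := by simpa using hc
  have hi1 : ∀ i, Integrable (fun ω => p (X i ω)) μ := fun i =>
    Integrable.of_bound (hp.comp (hX i)).aestronglyMeasurable 1
      (Filter.Eventually.of_forall fun ω => hp1 _)
  have hi2 : ∀ i j, Integrable (fun ω => p (X i ω) * p (X j ω)) μ := fun i j =>
    Integrable.of_bound ((hp.comp (hX i)).mul (hp.comp (hX j))).aestronglyMeasurable 1
      (Filter.Eventually.of_forall fun ω => by
        rw [norm_mul]; exact mul_le_one₀ (hp1 _) (norm_nonneg _) (hp1 _))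
  have hi3 : ∀ i j, Integrable (fun ω => (p (X i ω) - m) * (p (X j ω) - m)) μ := fun i j => by
    have : (fun ω => (p (X i ω) - m) * (p (X j ω) - m)) = fun ω =>
        p (X i ω) * p (X j ω) - m * p (X j ω) - m * p (X i ω) + m * m := by ext ω; ring
    rw [this]
    exact (((hi2 i j).sub ((hi1 j).const_mul m)).sub ((hi1 i).const_mul m)).add
      (integrable_const _)
  have hcov : ∀ i j, ∫ ω, (p (X i ω) - m) * (p (X j ω) - m) ∂μ
      = ∫ ω, p (X i ω) * p (X j ω) ∂μ - m * m := fun i j => by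
    have e : ∀ ω, (p (X i ω) - m) * (p (X j ω) - m) =
        p (X i ω) * p (X j ω) - (m * p (X j ω) + (m * p (X i ω) - m * m)) := fun ω => by ring
    have i4 : Integrable (fun ω => m * p (X i ω) - m * m) μ :=
      ((hi1 i).const_mul m).sub (integrable_const _)
    have i5 : Integrable (fun ω => m * p (X j ω) + (m * p (X i ω) - m * m)) μ :=
      ((hi1 j).const_mul m).add i4
    simp only [e]
    rw [integral_sub (hi2 i j) i5, integral_add ((hi1 j).const_mul m) i4,
      integral_sub ((hi1 i).const_mul m) (integrable_const _), integral_const_mul,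
      integral_const_mul, hm, hm]
    simp
  have hle : ∀ i j, ∫ ω, (p (X i ω) - m) * (p (X j ω) - m) ∂μ
      ≤ 2 * Real.exp (-c) ^ (Nat.dist i j) := by
    have hlt : ∀ i k : ℕ, ∫ ω, p (X i ω) * p (X (i + k) ω) ∂μ - m * m
        ≤ 2 * Real.exp (-c) ^ k := fun i k => by
      have h1 := h p hp hp1 i k
      rw [hm, hm] at h1
      rw [← Real.exp_nat_mul, mul_comm (k : ℝ)]
      exact (le_abs_self _).trans h1
    intro i j
    rw [hcov]
    rcases le_total i j with hij | hij
    · obtain ⟨k, rfl⟩ := Nat.exists_eq_add_of_le hij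
      rw [Nat.dist_eq_sub_of_le hij, Nat.add_sub_cancel_left]
      exact hlt i k
    · obtain ⟨k, rfl⟩ := Nat.exists_eq_add_of_le hij
      rw [Nat.dist_eq_sub_of_le_right hij, Nat.add_sub_cancel_left]
      simp only [mul_comm (p (X (j + k) _))]
      exact hlt j k
  have hexp : ∀ ω, (∑ k ∈ Finset.Icc 1 n, (p (X k ω) - m)) ^ 2
      = ∑ i ∈ Finset.Icc 1 n, ∑ j ∈ Finset.Icc 1 n, (p (X i ω) - m) * (p (X j ω) - m) :=
    fun ω => by rw [sq, Finset.sum_mul_sum]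
  simp only [hexp]
  rw [integral_finsetSum _ fun i _ => integrable_finsetSum _ fun j _ => hi3 i j]
  calc ∑ i ∈ Finset.Icc 1 n, ∫ ω, ∑ j ∈ Finset.Icc 1 n, (p (X i ω) - m) * (p (X j ω) - m) ∂μ
      ≤ ∑ i ∈ Finset.Icc 1 n, 4 * (1 - Real.exp (-c))⁻¹ := by
        refine Finset.sum_le_sum fun i _ => ?_
        rw [integral_finsetSum _ fun j _ => hi3 i j]
        refine (Finset.sum_le_sum fun j _ => hle i j).trans ?_
        rw [← Finset.mul_sum]
        have := sum_pow_dist_le (Real.exp_pos (-c)).le hr1 n i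
        linarith
    _ = _ := by simp; ring

/-- Deviation of the empirical characteristic function at `t`. -/
def empDev (X : ℕ → Ω → ℝ) (g : ℝ → ℝ) (n : ℕ) (ω : Ω) (t : ℝ) : ℂ :=
  (1 / n : ℝ) * ∑ k ∈ Finset.Icc 1 n, Complex.exp (Complex.I * t * X k ω) - ft g t

lemma norm_ft_le_one {ν : Measure ℝ} [IsProbabilityMeasure ν] (hg : IsDensityOf g ν) (t : ℝ) :
    ‖ft g t‖ ≤ 1 := by
  rw [← hg.integral_cexp]
  refine (norm_integral_le_of_norm_le_const (C := 1) (Filter.Eventually.of_forall fun e => ?_)).trans_eq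
    (by simp)
  rw [norm_cexp_I_mul]

lemma norm_empDev_le (hg : ∀ t, ‖ft g t‖ ≤ 1) {n : ℕ} (hn : 0 < n) (ω : Ω) (t : ℝ) :
    ‖empDev X g n ω t‖ ≤ 2 := by
  have hn' : (0 : ℝ) < n := by exact_mod_cast hn
  refine (norm_sub_le _ _).trans ?_
  have h1 : ‖((1 / n : ℝ) : ℂ) * ∑ k ∈ Finset.Icc 1 n, Complex.exp (Complex.I * t * X k ω)‖ ≤ 1 := by
    rw [norm_mul, Complex.norm_real, Real.norm_of_nonneg (by positivity), one_div,
      inv_mul_le_iff₀ hn', mul_one]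
    refine (norm_sum_le _ _).trans_eq ?_
    simp [norm_cexp_I_mul]
  linarith [hg t]

lemma measurable_empDev (hX : ∀ i, Measurable (X i)) (hg : Integrable g) (n : ℕ) :
    Measurable fun p : Ω × ℝ => empDev X g n p.1 p.2 := by
  have h1 := (continuous_ft hg).measurable
  have h2 : ∀ k, Measurable fun p : Ω × ℝ => Complex.exp (Complex.I * p.2 * X k p.1) := fun k =>
    Complex.continuous_exp.measurable.comp (by
      have h3 : Measurable fun p : Ω × ℝ => ((X k p.1 : ℝ) : ℂ) :=
        Complex.measurable_ofReal.comp ((hX k).comp measurable_fst)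
      fun_prop)
  exact ((Finset.measurable_sum _ fun k _ => h2 k).const_mul _).sub (h1.comp measurable_snd)

/-- The squared modulus splits into cosine and sine sums, both of functions bounded by `1`, which is
why covariance decay for real functions suffices. -/
lemma CovDecay.integral_norm_empDev_sq_le (h : CovDecay μ X c) (hX : ∀ i, Measurable (X i))
    (hc : 0 < c) (hg : ∀ i, IsDensityOf g (μ.map (X i))) {n : ℕ} (hn : 0 < n) (t : ℝ) :
    ∫ ω, ‖empDev X g n ω t‖ ^ 2 ∂μ ≤ 8 * (1 - Real.exp (-c))⁻¹ / n := by
  have hn' : (0 : ℝ) < n := by exact_mod_cast hn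
  have hmean : ∀ i, ∫ ω, Complex.exp (Complex.I * t * X i ω) ∂μ = ft g t := fun i => by
    rw [← (hg i).integral_cexp,
      integral_map (hX i).aemeasurable (Continuous.aestronglyMeasurable (by fun_prop))]
  have hint : ∀ i, Integrable (fun ω => Complex.exp (Complex.I * t * X i ω)) μ := fun i => by
    refine Integrable.of_bound (Measurable.aestronglyMeasurable ?_) 1
      (Filter.Eventually.of_forall fun ω => (norm_cexp_I_mul _ _).le)
    exact Complex.continuous_exp.measurable.comp
      ((Complex.measurable_ofReal.comp (hX i)).const_mul _)
  have hre : ∀ i, ∫ ω, Real.cos (t * X i ω) ∂μ = (ft g t).re := fun i => by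
    have := integral_re (hint i)
    simp only [RCLike.re_eq_complex_re, hmean] at this
    rw [← this]
    congr 1 with ω
    rw [mul_assoc, mul_comm Complex.I, ← Complex.ofReal_mul, Complex.exp_ofReal_mul_I_re]
  have him : ∀ i, ∫ ω, Real.sin (t * X i ω) ∂μ = (ft g t).im := fun i => by
    have := integral_im (hint i)
    simp only [RCLike.im_eq_complex_im, hmean] at this
    rw [← this]
    congr 1 with ω
    rw [mul_assoc, mul_comm Complex.I, ← Complex.ofReal_mul, Complex.exp_ofReal_mul_I_im]
  have hcos := h.integral_sum_sq_le hX hc (p := fun y => Real.cos (t * y)) (by fun_prop)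
    (fun y => Real.abs_cos_le_one _) hre n
  have hsin := h.integral_sum_sq_le hX hc (p := fun y => Real.sin (t * y)) (by fun_prop)
    (fun y => Real.abs_sin_le_one _) him n
  have hsq : ∀ {p : ℝ → ℝ} (m : ℝ), Measurable p → (∀ y, |p y| ≤ 1) →
      Integrable (fun ω => (∑ k ∈ Finset.Icc 1 n, (p (X k ω) - m)) ^ 2) μ := by
    intro p m hp hp1
    refine Integrable.of_bound (Measurable.aestronglyMeasurable ?_) ((n * (1 + |m|)) ^ 2)
      (Filter.Eventually.of_forall fun ω => ?_)
    · exact (Finset.measurable_sum _ fun k _ => (hp.comp (hX k)).sub_const m).pow_const 2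
    · rw [norm_pow]
      refine pow_le_pow_left₀ (norm_nonneg _) ((norm_sum_le _ _).trans
        ((Finset.sum_le_card_nsmul _ _ (1 + |m|) fun k _ => ?_).trans_eq (by simp; ring))) 2
      exact (norm_sub_le _ _).trans (add_le_add_left (hp1 _) _)
  have hdec : ∀ ω, ‖empDev X g n ω t‖ ^ 2 = (1 / n : ℝ) ^ 2 *
      ((∑ k ∈ Finset.Icc 1 n, (Real.cos (t * X k ω) - (ft g t).re)) ^ 2
        + (∑ k ∈ Finset.Icc 1 n, (Real.sin (t * X k ω) - (ft g t).im)) ^ 2) := by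
    intro ω
    have e : empDev X g n ω t = ((1 / n : ℝ) : ℂ) *
        ∑ k ∈ Finset.Icc 1 n, (Complex.exp (Complex.I * t * X k ω) - ft g t) := by
      rw [empDev, Finset.sum_sub_distrib, mul_sub]
      congr 1
      have hnc : (n : ℂ) ≠ 0 := by exact_mod_cast hn.ne'
      simp
      field_simp
    rw [e, norm_mul, mul_pow, Complex.norm_real, Real.norm_eq_abs, sq_abs, ← Complex.normSq_eq_norm_sq,
      Complex.normSq_apply, ← sq, ← sq, Complex.re_sum, Complex.im_sum]
    congr 4
    · ext k
      rw [Complex.sub_re, mul_assoc, mul_comm Complex.I, ← Complex.ofReal_mul,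
        Complex.exp_ofReal_mul_I_re]
    · ext k
      rw [Complex.sub_im, mul_assoc, mul_comm Complex.I, ← Complex.ofReal_mul,
        Complex.exp_ofReal_mul_I_im]
  simp only [hdec]
  rw [integral_const_mul, integral_add
    (hsq (p := fun y => Real.cos (t * y)) _ (by fun_prop) fun y => Real.abs_cos_le_one _)
    (hsq (p := fun y => Real.sin (t * y)) _ (by fun_prop) fun y => Real.abs_sin_le_one _)]
  calc (1 / n : ℝ) ^ 2 * _ ≤ (1 / n : ℝ) ^ 2 *
        (4 * (1 - Real.exp (-c))⁻¹ * n + 4 * (1 - Real.exp (-c))⁻¹ * n) := by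
        gcongr
    _ = _ := by field_simp; ring

/-- Weighted `L¹` deviation of the empirical characteristic function. -/
def empLoss (ψ : ℝ → ℝ) (X : ℕ → Ω → ℝ) (g : ℝ → ℝ) (n : ℕ) (ω : Ω) : ℝ :=
  (1 / (2 * Real.pi)) * ∫ t, ‖ft ψ (-t)‖ * ‖empDev X g n ω t‖

/-- Cauchy-Schwarz for the weight `w`: the integral of `w (d - s)²` is a nonnegative quadratic in
`s`, so its discriminant is nonpositive. -/
lemma sq_integral_mul_le {w d : ℝ → ℝ} (hw : Integrable w) (hw0 : ∀ t, 0 ≤ w t)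
    (hd : Measurable d) {B : ℝ} (hdB : ∀ t, |d t| ≤ B) :
    (∫ t, w t * d t) ^ 2 ≤ (∫ t, w t) * ∫ t, w t * d t ^ 2 := by
  have i1 : Integrable (fun t => w t * d t) :=
    hw.mul_bdd (c := B) hd.aestronglyMeasurable (Filter.Eventually.of_forall hdB)
  have i2 : Integrable (fun t => w t * d t ^ 2) :=
    hw.mul_bdd (c := B ^ 2) (hd.pow_const 2).aestronglyMeasurable
      (Filter.Eventually.of_forall fun t => by
        rw [norm_pow]; exact pow_le_pow_left₀ (norm_nonneg _) (hdB t) 2)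
  have hquad : ∀ s : ℝ, 0 ≤ (∫ t, w t) * (s * s) + (-2 * ∫ t, w t * d t) * s
      + ∫ t, w t * d t ^ 2 := by
    intro s
    have e : ∀ t, w t * (s * s) + ((-2 * s) * (w t * d t) + w t * d t ^ 2) = w t * (d t - s) ^ 2 :=
      fun t => by ring
    have i3 : Integrable (fun t => (-2 * s) * (w t * d t) + w t * d t ^ 2) :=
      (i1.const_mul _).add i2
    have h0 : 0 ≤ ∫ t, (w t * (s * s) + ((-2 * s) * (w t * d t) + w t * d t ^ 2)) := by
      refine integral_nonneg fun t => ?_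
      simp only [e]
      exact mul_nonneg (hw0 t) (sq_nonneg _)
    rw [integral_add (hw.mul_const _) i3, integral_add (i1.const_mul _) i2, integral_mul_const,
      integral_const_mul] at h0
    linarith
  have := discrim_le_zero hquad
  rw [discrim] at this
  nlinarith

variable {ψ : ℝ → ℝ}

lemma integrable_ft_mul_empDev (hψ : Integrable (ft ψ)) (hX : ∀ i, Measurable (X i))
    (hgi : Integrable g) (hg : ∀ t, ‖ft g t‖ ≤ 1) {n : ℕ} (hn : 0 < n) (ω : Ω) :
    Integrable fun t => ‖ft ψ (-t)‖ * ‖empDev X g n ω t‖ :=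
  hψ.comp_neg.norm.mul_bdd (c := 2)
    (((measurable_empDev hX hgi n).comp measurable_prodMk_left).norm).aestronglyMeasurable
    (Filter.Eventually.of_forall fun t => by rw [norm_norm]; exact norm_empDev_le hg hn ω t)

lemma measurable_empLoss (hψ : Integrable ψ) (hX : ∀ i, Measurable (X i))
    (hgi : Integrable g) (n : ℕ) : Measurable (empLoss ψ X g n) := by
  refine Measurable.const_mul (StronglyMeasurable.measurable ?_) _
  refine StronglyMeasurable.integral_prod_right (f := fun (ω : Ω) (t : ℝ) =>
    ‖ft ψ (-t)‖ * ‖empDev X g n ω t‖) (Measurable.stronglyMeasurable ?_)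
  exact ((((continuous_ft hψ).measurable.comp measurable_neg).comp measurable_snd).norm).mul
    (measurable_empDev hX hgi n).norm

lemma empLoss_nonneg (n : ℕ) (ω : Ω) : 0 ≤ empLoss ψ X g n ω :=
  mul_nonneg (by positivity) (integral_nonneg fun t => by positivity)

lemma empLoss_sq_le (hψ' : Integrable (ft ψ)) (hX : ∀ i, Measurable (X i))
    (hgi : Integrable g) (hg : ∀ t, ‖ft g t‖ ≤ 1) {n : ℕ} (hn : 0 < n) (ω : Ω) :
    empLoss ψ X g n ω ^ 2 ≤ (1 / (2 * Real.pi)) ^ 2 * ((∫ t, ‖ft ψ t‖) *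
      ∫ t, ‖ft ψ (-t)‖ * ‖empDev X g n ω t‖ ^ 2) := by
  rw [empLoss, mul_pow]
  gcongr
  have := sq_integral_mul_le hψ'.comp_neg.norm (fun t => norm_nonneg _)
    (d := fun t => ‖empDev X g n ω t‖)
    ((measurable_empDev hX hgi n).comp measurable_prodMk_left).norm (B := 2)
    (fun t => by rw [abs_norm]; exact norm_empDev_le hg hn ω t)
  rwa [integral_neg_eq_self (fun t => ‖ft ψ t‖)] at this

lemma integrable_empLoss_sq (hψ : Integrable ψ) (hψ' : Integrable (ft ψ))
    (hX : ∀ i, Measurable (X i)) (hgi : Integrable g) (hg : ∀ t, ‖ft g t‖ ≤ 1) {n : ℕ}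
    (hn : 0 < n) : Integrable (fun ω => empLoss ψ X g n ω ^ 2) μ := by
  refine Integrable.of_bound ((measurable_empLoss hψ hX hgi n).pow_const 2).aestronglyMeasurable
    (((1 / (2 * Real.pi)) * ((∫ t, ‖ft ψ t‖) * 2)) ^ 2) (Filter.Eventually.of_forall fun ω => ?_)
  rw [norm_pow, Real.norm_of_nonneg (empLoss_nonneg n ω), empLoss]
  have h0 : 0 ≤ ∫ t, ‖ft ψ (-t)‖ * ‖empDev X g n ω t‖ :=
    integral_nonneg fun t => by positivity
  gcongr
  rw [← integral_neg_eq_self (fun t => ‖ft ψ t‖), ← integral_mul_const]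
  refine integral_mono (integrable_ft_mul_empDev hψ' hX hgi hg hn ω)
    (hψ'.comp_neg.norm.mul_const 2) fun t => ?_
  simp only
  gcongr
  exact norm_empDev_le hg hn ω t

/-- The weighted deviation of the empirical characteristic function is of parametric order. -/
lemma CovDecay.integral_empLoss_sq_le (h : CovDecay μ X c) (hX : ∀ i, Measurable (X i))
    (hc : 0 < c) (hg : ∀ i, IsDensityOf g (μ.map (X i))) (hψ : Integrable ψ)
    (hψ' : Integrable (ft ψ)) {n : ℕ} (hn : 0 < n) :
    ∫ ω, empLoss ψ X g n ω ^ 2 ∂μ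
      ≤ (∫ t, ‖ft ψ t‖) ^ 2 * (8 * (1 - Real.exp (-c))⁻¹) / n := by
  have hprob : IsProbabilityMeasure (μ.map (X 0)) :=
    Measure.isProbabilityMeasure_map (hX 0).aemeasurable
  have hgi : Integrable g := (hg 0).integrable
  have hg1 := norm_ft_le_one (hg 0)
  have hW : 0 ≤ ∫ t, ‖ft ψ t‖ := integral_nonneg fun t => norm_nonneg _
  have hpi : (1 / (2 * Real.pi)) ^ 2 ≤ 1 := by
    refine pow_le_one₀ (by positivity) ?_
    rw [div_le_one (by positivity)]
    linarith [Real.pi_gt_three]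
  have hprod : Integrable (Function.uncurry fun (ω : Ω) (t : ℝ) =>
      ‖ft ψ (-t)‖ * ‖empDev X g n ω t‖ ^ 2) (μ.prod volume) := by
    have h1 : Integrable (fun p : Ω × ℝ => (1 : ℝ) * ‖ft ψ (-p.2)‖) (μ.prod volume) :=
      (integrable_const (1 : ℝ)).mul_prod hψ'.comp_neg.norm
    simp only [one_mul] at h1
    refine h1.mul_bdd (c := 2 ^ 2)
      ((measurable_empDev hX hgi n).norm.pow_const 2).aestronglyMeasurable
      (Filter.Eventually.of_forall fun p => ?_)
    rw [norm_pow, norm_norm]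
    exact pow_le_pow_left₀ (norm_nonneg _) (norm_empDev_le hg1 hn p.1 p.2) 2
  calc ∫ ω, empLoss ψ X g n ω ^ 2 ∂μ
      ≤ ∫ ω, (1 / (2 * Real.pi)) ^ 2 * ((∫ t, ‖ft ψ t‖) *
        ∫ t, ‖ft ψ (-t)‖ * ‖empDev X g n ω t‖ ^ 2) ∂μ :=
        integral_mono (integrable_empLoss_sq hψ hψ' hX hgi hg1 hn)
          ((hprod.integral_prod_left.const_mul _).const_mul _)
          fun ω => empLoss_sq_le hψ' hX hgi hg1 hn ω
    _ = (1 / (2 * Real.pi)) ^ 2 * ((∫ t, ‖ft ψ t‖) *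
        ∫ t, ‖ft ψ (-t)‖ * ∫ ω, ‖empDev X g n ω t‖ ^ 2 ∂μ) := by
        rw [integral_const_mul, integral_const_mul, integral_integral_swap hprod]
        simp only [integral_const_mul]
    _ ≤ 1 * ((∫ t, ‖ft ψ t‖) *
        ∫ t, ‖ft ψ (-t)‖ * (8 * (1 - Real.exp (-c))⁻¹ / n)) := by
        gcongr ?_ * (_ * ?_)
        refine integral_mono_of_nonneg (Filter.Eventually.of_forall fun t =>
          mul_nonneg (norm_nonneg _) (integral_nonneg fun ω => by positivity))
          (hψ'.comp_neg.norm.mul_const _) (Filter.Eventually.of_forall fun t => ?_)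
        simp only
        gcongr
        exact h.integral_norm_empDev_sq_le hX hc hg hn t
    _ = _ := by
        rw [integral_mul_const, integral_neg_eq_self (fun t => ‖ft ψ t‖)]
        ring

/-- The state part of the estimation error is dominated by the weighted deviation of the empirical
characteristic function, uniformly in the integration domain. -/
lemma abs_sum_trig_sub_le (hψ : Integrable (ft ψ)) (hX : ∀ i, Measurable (X i))
    (hgi : Integrable g) (hg : ∀ t, ‖ft g t‖ ≤ 1) {n : ℕ} (hn : 0 < n) (A : Set ℝ) (ω : Ω) :
    |(1 / n : ℝ) * ∑ k ∈ Finset.Icc 1 n, trig (fun t => ft ψ (-t)) A (X k ω)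
        - (1 / (2 * Real.pi)) * (∫ t in A, ft ψ (-t) * ft g t).re| ≤ empLoss ψ X g n ω := by
  have hi : ∀ k, IntegrableOn (fun t : ℝ => Complex.exp (Complex.I * t * X k ω) * ft ψ (-t)) A :=
    fun k => by
      refine (hψ.comp_neg.mono ((Continuous.aestronglyMeasurable (by fun_prop)).mul
        hψ.comp_neg.aestronglyMeasurable) (Filter.Eventually.of_forall fun t => ?_)).integrableOn
      rw [Pi.mul_apply, norm_mul, norm_cexp_I_mul, one_mul]
  have hig : IntegrableOn (fun t => ft ψ (-t) * ft g t) A :=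
    (hψ.comp_neg.mul_bdd (c := 1) (continuous_ft hgi).aestronglyMeasurable
      (Filter.Eventually.of_forall hg)).integrableOn
  -- The whole error is one integral over `A` against `empDev`; bounding by absolute values and
  -- enlarging `A` to the line removes the dependence on the model.
  have e : (1 / n : ℝ) * ∑ k ∈ Finset.Icc 1 n, trig (fun t => ft ψ (-t)) A (X k ω)
        - (1 / (2 * Real.pi)) * (∫ t in A, ft ψ (-t) * ft g t).re
      = (1 / (2 * Real.pi)) * (∫ t in A, ft ψ (-t) * empDev X g n ω t).re := by
    have e1 : ∀ t : ℝ, ft ψ (-t) * empDev X g n ω t = ((1 / n : ℝ) : ℂ) *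
        (∑ k ∈ Finset.Icc 1 n, Complex.exp (Complex.I * t * X k ω) * ft ψ (-t))
          - ft ψ (-t) * ft g t := by
      intro t
      rw [empDev, ← Finset.sum_mul]
      ring
    simp only [e1]
    rw [integral_sub ((integrable_finsetSum _ fun k _ => hi k).const_mul _) hig,
      integral_const_mul, integral_finsetSum _ fun k _ => hi k, Complex.sub_re,
      Complex.re_ofReal_mul, Complex.re_sum, mul_sub]
    simp only [trig, ← Finset.mul_sum]
    ring
  rw [e, abs_mul, abs_of_pos (a := 1 / (2 * Real.pi)) (by positivity), empLoss]
  gcongr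
  refine (Complex.abs_re_le_norm _).trans ((norm_integral_le_integral_norm _).trans ?_)
  simp only [norm_mul]
  exact setIntegral_le_integral (integrable_ft_mul_empDev hψ hX hgi hg hn ω)
    (Filter.Eventually.of_forall fun t => by positivity)

end Mixing


/-! ### Deterministic analysis of the selection rule -/

section Selection

variable {M : Finset ℕ} {n : ℕ} {a : ℝ} {x : ℕ → ℝ} {s d : ℕ → ℕ → ℝ} {T : ℕ → ℝ} {m : ℕ}

/-- Since `M` is finite the minimum of the criterion is attained, so the set whose infimum defines
`mHat` is nonempty and contains that infimum. -/
lemma mHat_mem (hn : 0 < n) (hM : M.Nonempty) :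
    mHat M n a x s d T ∈ M ∧ ∀ m ∈ M, critHat M a x s d T (mHat M n a x s d T)
      ≤ critHat M a x s d T m + 1 / n := by
  have hn' : (0 : ℝ) < 1 / n := by positivity
  have : Nonempty M := hM.to_subtype
  have hbdd : BddBelow (Set.range fun j : M => critHat M a x s d T j) := (Set.finite_range _).bddBelow
  have hne : {m : ℕ | m ∈ M ∧ critHat M a x s d T m
      ≤ (⨅ j : M, critHat M a x s d T j) + 1 / n}.Nonempty := by
    obtain ⟨i, hi⟩ := exists_eq_ciInf_of_finite (f := fun j : M => critHat M a x s d T j)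
    refine ⟨i, i.2, ?_⟩
    rw [← hi]
    linarith
  obtain ⟨h1, h2⟩ := Nat.sInf_mem hne
  refine ⟨h1, fun m hm => h2.trans ?_⟩
  gcongr
  exact ciInf_le hbdd (⟨m, hm⟩ : M)

lemma le_critHat {j : ℕ} (hj : j ∈ M) (hmj : m ≤ j) :
    (T m - T j) ^ 2 - corr a x s d j m + pen a x s d m ≤ critHat M a x s d T m := by
  have : Finite {j : ℕ // j ∈ M ∧ m ≤ j} :=
    Finite.of_injective (fun j : {j : ℕ // j ∈ M ∧ m ≤ j} => (⟨j.1, j.2.1⟩ : M))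
      fun p q h => Subtype.ext (congrArg (fun r : M => (r : ℕ)) h)
  rw [critHat]
  gcongr
  exact le_ciSup (f := fun j : {j : ℕ // j ∈ M ∧ m ≤ j} => (T m - T j) ^ 2 - corr a x s d j m)
    (Set.finite_range _).bddAbove ⟨j, hj, hmj⟩

lemma critHat_le {B : ℝ} (hm : m ∈ M)
    (h : ∀ j ∈ M, m ≤ j → (T m - T j) ^ 2 - corr a x s d j m ≤ B) :
    critHat M a x s d T m ≤ B + pen a x s d m := by
  -- The index `m` itself is admissible, so the supremum is not the default value `0` of an empty
  -- one.
  have : Nonempty {j : ℕ // j ∈ M ∧ m ≤ j} := ⟨⟨m, hm, le_rfl⟩⟩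
  rw [critHat]
  gcongr
  exact ciSup_le fun j => h j j.2.1 j.2.2

/-- Positivity and monotonicity of variance or sup-norm terms indexed by pairs of models. -/
structure PairMono (s : ℕ → ℕ → ℝ) : Prop where
  nonneg : ∀ j m, 0 ≤ s j m
  le_zero_left : ∀ j m, m ≤ j → s j m ≤ s 0 j
  diag : ∀ j, s j j = 0

lemma corr_le_pen (ha : 0 < a) (hs : PairMono s) (hd : PairMono d) {j : ℕ} (hx : 0 ≤ x j)
    (hmj : m ≤ j) : corr a x s d j m ≤ pen a x s d j := by
  rw [corr, pen]
  gcongr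
  · exact hs.le_zero_left j m hmj
  · exact hd.nonneg j m
  · exact hd.le_zero_left j m hmj

lemma pen_nonneg (ha : 0 < a) (hs : PairMono s) (hx : 0 ≤ x m) : 0 ≤ pen a x s d m := by
  have := hs.nonneg 0 m
  rw [pen]
  positivity

/-- The selected model is controlled by the criterion at any competitor. -/
lemma sq_sub_le_critHat (ha : 0 < a) (hn : 0 < n) (hs : PairMono s) (hd : PairMono d)
    (hx : ∀ j ∈ M, 0 ≤ x j) (hm : m ∈ M) :
    (T (mHat M n a x s d T) - T m) ^ 2
      ≤ 2 * critHat M a x s d T m + 1 / n + pen a x s d m := by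
  obtain ⟨hmem, hcrit⟩ := mHat_mem (M := M) (n := n) (a := a) (x := x) (s := s) (d := d) (T := T)
    hn ⟨m, hm⟩
  set k := mHat M n a x s d T with hk
  have h0 := hcrit m hm
  -- The term `j = m` of the supremum vanishes, so the criterion dominates the penalty.
  have diag : ∀ j ∈ M, pen a x s d j ≤ critHat M a x s d T j := fun j hj => by
    have := le_critHat (a := a) (x := x) (s := s) (d := d) (T := T) hj (le_refl j)
    simpa [corr, hs.diag, hd.diag] using this
  have hpm := pen_nonneg (d := d) ha hs (hx m hm)
  have hpk := pen_nonneg (d := d) ha hs (hx k hmem)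
  have hdm := diag m hm
  have hdk := diag k hmem
  -- The larger of the two models lies in the range of the supremum at the smaller one; the
  -- correction it subtracts is bounded by the larger model's penalty.
  rcases le_total k m with hkm | hkm
  · have h1 := le_critHat (a := a) (x := x) (s := s) (d := d) (T := T) hm hkm
    have h2 := corr_le_pen ha hs hd (hx m hm) hkm
    linarith
  · have h1 := le_critHat (a := a) (x := x) (s := s) (d := d) (T := T) hmem hkm
    have h2 := corr_le_pen ha hs hd (hx k hmem) hkm
    have h3 : (T k - T m) ^ 2 = (T m - T k) ^ 2 := by ring
    linarith

/-- Half of the bias correction without the factor `1 + 1/a`. -/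
def halfCorr (x : ℕ → ℝ) (s d : ℕ → ℕ → ℝ) (j m : ℕ) : ℝ :=
  2 * (x j * s j m + x j ^ 2 * d j m ^ 2)

/-- Deterministic oracle inequality: noise terms `S`, a uniform remainder `R` and a bias `b`
control the error of the selected estimator. -/
theorem sq_selected_sub_le (ha : 0 < a) (hn : 0 < n) (hs : PairMono s) (hd : PairMono d)
    (hx : ∀ j ∈ M, 0 ≤ x j) (hm : m ∈ M) {t : ℕ → ℝ} {θ b R Q S₀ N₀ : ℝ} {S : ℕ → ℝ}
    (hb : |t m - θ| ≤ b) (hbj : ∀ j ∈ M, m ≤ j → |t j - t m| ≤ b)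
    (hS : ∀ j ∈ M, m ≤ j → |T j - T m - (t j - t m) - S j| ≤ R)
    (hQ : ∀ j ∈ M, m ≤ j → S j ^ 2 - halfCorr x s d j m ≤ Q) (hQ0 : 0 ≤ Q)
    (hS₀ : |T m - t m - S₀| ≤ R) (hN₀ : S₀ ^ 2 - halfCorr x s d m 0 ≤ N₀) (hN₀0 : 0 ≤ N₀) :
    (T (mHat M n a x s d T) - θ) ^ 2
      ≤ (18 + 4 * a + 8 / a) * (b ^ 2 + pen a x s d m + Q + N₀ + R ^ 2 + 1 / n) := by
  have h1 := sq_sub_le_critHat (T := T) ha hn hs hd hx hm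
  set k := mHat M n a x s d T
  have hp := pen_nonneg (d := d) ha hs (hx m hm)
  have hia : 0 < 1 / a := by positivity
  have hn0 : 0 ≤ (1 : ℝ) / n := by positivity
  have split : ∀ {y z : ℝ}, |y - z| ≤ R → y ^ 2 ≤ 2 * z ^ 2 + 2 * R ^ 2 := by
    intro y z h
    have : (y - z) ^ 2 ≤ R ^ 2 := sq_le_sq' (abs_le.1 h).1 (abs_le.1 h).2
    nlinarith [sq_nonneg (y - z - z)]
  have hcrit : critHat M a x s d T m
      ≤ ((1 + 1 / a) * (2 * Q + 2 * R ^ 2) + (1 + a) * b ^ 2) + pen a x s d m := by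
    refine critHat_le hm fun j hj hmj => ?_
    set e := T j - T m - (t j - t m) with he
    have h2 := split (hS j hj hmj)
    have h3 := hQ j hj hmj
    have hbb : (t j - t m) ^ 2 ≤ b ^ 2 := sq_le_sq' (abs_le.1 (hbj j hj hmj)).1
      (abs_le.1 (hbj j hj hmj)).2
    -- Young's inequality with weight `a`. Its factor `1 + 1/a` on the stochastic part is exactly
    -- the one built into the correction and the penalty.
    have h4 : (T m - T j) ^ 2 ≤ (1 + 1 / a) * e ^ 2 + (1 + a) * (t j - t m) ^ 2 := by
      have e1 : T m - T j = -(e + (t j - t m)) := by rw [he]; ring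
      have e2 : (1 + 1 / a) * e ^ 2 + (1 + a) * (t j - t m) ^ 2 - (e + (t j - t m)) ^ 2
          = (e - a * (t j - t m)) ^ 2 / a := by field_simp; ring
      have e3 : 0 ≤ (e - a * (t j - t m)) ^ 2 / a := by positivity
      rw [e1, neg_sq]
      linarith
    have h5 : corr a x s d j m = (1 + 1 / a) * (2 * halfCorr x s d j m) := by
      rw [corr, halfCorr]; ring
    have h6 : (1 + 1 / a) * e ^ 2 - (1 + 1 / a) * (2 * halfCorr x s d j m)
        ≤ (1 + 1 / a) * (2 * Q + 2 * R ^ 2) := by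
      rw [← mul_sub]
      gcongr
      linarith
    have h7 : (1 + a) * (t j - t m) ^ 2 ≤ (1 + a) * b ^ 2 := by gcongr
    rw [h5]
    linarith
  -- The error of the competitor is treated as a comparison with model `0`, where both estimator and
  -- target vanish.
  have h8 : (T m - t m) ^ 2 ≤ 2 * N₀ + 2 * R ^ 2 + pen a x s d m := by
    have h9 := split hS₀
    have h10 : 2 * halfCorr x s d m 0 ≤ pen a x s d m := by
      refine le_trans ?_ (corr_le_pen ha hs hd (hx m hm) (Nat.zero_le m))
      have h11 : corr a x s d m 0 = (1 + 1 / a) * (2 * halfCorr x s d m 0) := by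
        rw [corr, halfCorr]; ring
      have h12 : 0 ≤ halfCorr x s d m 0 := by
        have := hs.nonneg m 0
        have := hx m hm
        rw [halfCorr]
        positivity
      rw [h11]
      nlinarith
    linarith
  have hbb : (t m - θ) ^ 2 ≤ b ^ 2 := sq_le_sq' (abs_le.1 hb).1 (abs_le.1 hb).2
  have h13 : (T m - θ) ^ 2 ≤ 2 * (T m - t m) ^ 2 + 2 * (t m - θ) ^ 2 := by
    nlinarith [sq_nonneg (T m - t m - (t m - θ))]
  have h14 : (T k - θ) ^ 2 ≤ 2 * (T k - T m) ^ 2 + 2 * (T m - θ) ^ 2 := by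
    nlinarith [sq_nonneg (T k - T m - (T m - θ))]
  have hfin : (T k - θ) ^ 2 ≤ 10 * pen a x s d m + (8 + 4 * a) * b ^ 2 + 8 * (1 + 1 / a) * Q
      + 8 * N₀ + (16 + 8 * (1 / a)) * R ^ 2 + 2 * (1 / n) := by
    linarith
  refine hfin.trans ?_
  rw [show (8 : ℝ) / a = 8 * (1 / a) by ring]
  have hb2 := sq_nonneg b
  have hR2 := sq_nonneg R
  have p1 := mul_nonneg ha.le hp
  have p2 := mul_nonneg ha.le hQ0
  have p3 := mul_nonneg ha.le hN₀0
  have p4 := mul_nonneg ha.le hR2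
  have p5 := mul_nonneg ha.le hn0
  have q1 := mul_nonneg hia.le hp
  have q2 := mul_nonneg hia.le hb2
  have q3 := mul_nonneg hia.le hN₀0
  have q5 := mul_nonneg hia.le hn0
  linarith

end Selection

/-! ### Measurability of the selected estimator -/

section Measurability

variable {Ω : Type*} [MeasurableSpace Ω] {M : Finset ℕ} {n : ℕ} {a : ℝ} {x : ℕ → ℝ}
  {s d : ℕ → ℕ → ℝ} {T : Ω → ℕ → ℝ}

lemma measurable_critHat (hT : ∀ m, Measurable fun ω => T ω m) (m : ℕ) :
    Measurable fun ω => critHat M a x s d (T ω) m := by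
  refine Measurable.add_const (Measurable.iSup fun j => ?_) _
  exact (((hT m).sub (hT j)).pow_const 2).sub_const _

lemma measurable_mHat (hT : ∀ m, Measurable fun ω => T ω m) :
    Measurable fun ω => mHat M n a x s d (T ω) := by
  set P : ℕ → Set Ω := fun m => {ω | m ∈ M ∧ critHat M a x s d (T ω) m
    ≤ (⨅ j : M, critHat M a x s d (T ω) j) + 1 / n} with hP
  have hPm : ∀ m, MeasurableSet (P m) := fun m => by
    refine (MeasurableSet.const _).inter (measurableSet_le (measurable_critHat hT m) ?_)
    exact (Measurable.iInf fun j : M => measurable_critHat hT j).add_const _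
  refine measurable_of_Iic fun k => ?_
  -- The last set collects the points where no index is admissible; there the infimum of the empty
  -- set is `0`, which lies below every `k`.
  have : (fun ω => mHat M n a x s d (T ω)) ⁻¹' Set.Iic k
      = (⋃ i ∈ Set.Iic k, P i) ∪ ⋂ i, (P i)ᶜ := by
    ext ω
    simp only [Set.mem_preimage, Set.mem_Iic, Set.mem_union, Set.mem_iUnion, Set.mem_iInter,
      Set.mem_compl_iff, exists_prop, mHat]
    constructor
    · intro h
      by_cases hne : {m : ℕ | ω ∈ P m}.Nonempty
      · exact Or.inl ⟨_, h, Nat.sInf_mem hne⟩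
      · exact Or.inr fun i hi => hne ⟨i, hi⟩
    · rintro (⟨i, hik, hi⟩ | h)
      · exact (Nat.sInf_le hi).trans hik
      · have : {m : ℕ | m ∈ M ∧ critHat M a x s d (T ω) m
            ≤ (⨅ j : M, critHat M a x s d (T ω) j) + 1 / n} = ∅ :=
          Set.eq_empty_of_forall_notMem h
        rw [this]
        simp
  rw [this]
  exact (MeasurableSet.biUnion (Set.to_countable _) fun i _ => hPm i).union
    (MeasurableSet.iInter fun i => (hPm i).compl)

lemma measurable_selected (hT : ∀ m, Measurable fun ω => T ω m) :
    Measurable fun ω => T ω (mHat M n a x s d (T ω)) :=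
  (measurable_from_prod_countable_left (f := fun p : Ω × ℕ => T p.1 p.2) hT).comp
    (measurable_id.prodMk (measurable_mHat hT))

end Measurability


/-! ### Kernels of the deconvolution estimator -/

/-- The integrand `ψ^*(-t) / f^*(t)` of the estimator. -/
def ratio (ψ f : ℝ → ℝ) (t : ℝ) : ℂ := ft ψ (-t) / ft f t

/-- Integrability and non-vanishing conditions making the estimator meaningful. -/
structure Regular (ψ f : ℝ → ℝ) : Prop where
  integrable_psi : Integrable ψ
  integrable_f : Integrable f
  ft_ne_zero : ∀ x, ft f x ≠ 0

/-- The minimum in the definition of `sigmaSq`. -/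
def minTerm (ψ f : ℝ → ℝ) (j m : ℕ) : ENNReal :=
  min (Ceps f * ∫⁻ x in annulus j m, ‖ft ψ x / ft f x‖ₑ ^ 2)
    ((∫⁻ x in annulus j m, ‖ft ψ x / ft f x‖ₑ) ^ 2)

/-- The interval `|t| ≤ π m`. -/
def band (m : ℕ) : Set ℝ := {t : ℝ | |t| ≤ Real.pi * m}

section Kernel

variable {ψ f g : ℝ → ℝ}

lemma Regular.continuous_ratio (h : Regular ψ f) : Continuous (ratio ψ f) :=
  ((continuous_ft h.integrable_psi).comp continuous_neg).div (continuous_ft h.integrable_f)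
    h.ft_ne_zero

lemma norm_ratio (t : ℝ) : ‖ratio ψ f t‖ = ‖ft ψ t / ft f t‖ := by
  rw [ratio, norm_div, norm_div, norm_ft_neg]

lemma enorm_ratio (t : ℝ) : ‖ratio ψ f t‖ₑ = ‖ft ψ t / ft f t‖ₑ := by
  rw [← ofReal_norm, norm_ratio, ofReal_norm]

lemma measurableSet_band (m : ℕ) : MeasurableSet (band m) :=
  measurableSet_le measurable_norm measurable_const

lemma annulus_subset_band {j m : ℕ} (h : m ≤ j) : annulus j m ⊆ band j := by
  rintro t ⟨_, h2⟩
  rw [max_eq_left h] at h2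
  exact h2

lemma annulus_zero (j : ℕ) : annulus 0 j = band j := by
  ext t
  simp [annulus, band]

lemma volume_abs_eq (y : ℝ) : volume {t : ℝ | |t| = y} = 0 := by
  refine Set.Finite.measure_zero ((Set.toFinite {y, -y}).subset fun t ht => ?_) _
  rcases abs_choice t with h | h
  · left; rw [← h]; exact ht
  · right
    have : |t| = y := ht
    rw [Set.mem_singleton_iff, ← this, h, neg_neg]

lemma volume_annulus_self (j : ℕ) : volume (annulus j j) = 0 := by
  refine measure_mono_null (fun t ht => ?_) (volume_abs_eq (Real.pi * j))
  obtain ⟨h1, h2⟩ := ht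
  rw [min_self] at h1
  rw [max_self] at h2
  exact le_antisymm h2 h1

lemma setIntegral_band_zero (F : ℝ → ℂ) : ∫ t in band 0, F t = 0 := by
  rw [← annulus_zero, Measure.restrict_eq_zero.2 (volume_annulus_self 0), integral_zero_measure]

lemma band_subset_band {j m : ℕ} (h : m ≤ j) : band m ⊆ band j := fun t ht =>
  le_trans (show |t| ≤ Real.pi * m from ht) (by gcongr)

/-- The annulus is closed at its inner radius, so it differs from the difference of the bands only
by points with `|t| = π m`, a null set. -/
lemma setIntegral_band_sub {F : ℝ → ℂ} {j m : ℕ} (h : m ≤ j) (hF : IntegrableOn F (band j)) :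
    (∫ t in band j, F t) - ∫ t in band m, F t = ∫ t in annulus j m, F t := by
  rw [← setIntegral_sdiff (measurableSet_band m) hF (band_subset_band h)]
  refine setIntegral_congr_set ?_
  rw [ae_eq_set]
  constructor
  · rw [Set.sdiff_eq_empty.2, measure_empty]
    rintro t ⟨h1, h2⟩
    refine ⟨?_, ?_⟩
    · rw [min_eq_right h]; exact (not_le.1 h2).le
    · rw [max_eq_left h]; exact h1
  · refine measure_mono_null ?_ (volume_abs_eq (Real.pi * m))
    rintro t ⟨⟨h1, h2⟩, h3⟩
    rw [min_eq_right h] at h1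
    rw [max_eq_left h] at h2
    refine le_antisymm ?_ h1
    by_contra h4
    exact h3 ⟨h2, h4⟩

lemma integrableOn_band {F : ℝ → ℂ} (hF : Continuous F) (j : ℕ) : IntegrableOn F (band j) := by
  refine (hF.integrableOn_Icc (a := -(Real.pi * j)) (b := Real.pi * j)).mono_set fun t ht => ?_
  exact abs_le.1 ht

lemma thetaHat_eq (n m : ℕ) (z : ℕ → ℝ) : thetaHat ψ f n m z
    = (1 / n : ℝ) * ∑ k ∈ Finset.Icc 1 n, trig (ratio ψ f) (band m) (z k) := by
  simp only [thetaHat, trig, ← Finset.mul_sum]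
  rw [← mul_assoc]
  congr 1
  field_simp

lemma trig_band_sub {h : ℝ → ℂ} (hh : Continuous h) {j m : ℕ} (hmj : m ≤ j) (z : ℝ) :
    trig h (band j) z - trig h (band m) z = trig h (annulus j m) z := by
  rw [trig, trig, trig, ← mul_sub, ← Complex.sub_re, setIntegral_band_sub hmj]
  exact integrableOn_band (by fun_prop) j

lemma Regular.thetaHat_sub (h : Regular ψ f) (n : ℕ) {j m : ℕ} (hmj : m ≤ j) (z : ℕ → ℝ) :
    thetaHat ψ f n j z - thetaHat ψ f n m z
      = (1 / n : ℝ) * ∑ k ∈ Finset.Icc 1 n, trig (ratio ψ f) (annulus j m) (z k) := by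
  rw [thetaHat_eq, thetaHat_eq, ← mul_sub, ← Finset.sum_sub_distrib]
  simp only [trig_band_sub h.continuous_ratio hmj]

lemma thetaHat_zero (n : ℕ) (z : ℕ → ℝ) : thetaHat ψ f n 0 z = 0 := by
  rw [thetaHat_eq]
  simp [trig, setIntegral_band_zero]

/-- Truncation of the functional at frequency `π m`. -/
def thetaTrunc (ψ g : ℝ → ℝ) (m : ℕ) : ℝ :=
  (1 / (2 * Real.pi)) * (∫ t in band m, ft ψ (-t) * ft g t).re

lemma thetaTrunc_zero : thetaTrunc ψ g 0 = 0 := by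
  simp [thetaTrunc, setIntegral_band_zero]

lemma thetaTrunc_sub (hψ : Integrable ψ) (hg : Integrable g) {j m : ℕ} (hmj : m ≤ j) :
    thetaTrunc ψ g j - thetaTrunc ψ g m
      = (1 / (2 * Real.pi)) * (∫ t in annulus j m, ft ψ (-t) * ft g t).re := by
  rw [thetaTrunc, thetaTrunc, ← mul_sub, ← Complex.sub_re, setIntegral_band_sub hmj]
  exact integrableOn_band (((continuous_ft hψ).comp continuous_neg).mul (continuous_ft hg)) j

lemma one_div_two_pi_le_one : 1 / (2 * Real.pi) ≤ 1 := by
  rw [div_le_one (by positivity)]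
  linarith [Real.pi_gt_three]

/-- `biasBound` carries no factor `1 / (2π)`; that factor is at most `1` and is discarded. -/
lemma abs_setIntegral_le_biasBound (hi : Integrable (fun x => ft ψ x * ft g x)) {m : ℕ}
    {A : Set ℝ} (hA : A ⊆ {x : ℝ | Real.pi * m ≤ |x|}) :
    |(1 / (2 * Real.pi)) * (∫ t in A, ft ψ (-t) * ft g t).re| ≤ biasBound ψ g m := by
  have hn : ∀ t, ‖ft ψ (-t) * ft g t‖ = ‖ft ψ t * ft g t‖ := fun t => by
    rw [norm_mul, norm_mul, norm_ft_neg]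
  rw [abs_mul, abs_of_pos (a := 1 / (2 * Real.pi)) (by positivity)]
  refine (mul_le_of_le_one_left (abs_nonneg _) one_div_two_pi_le_one).trans ?_
  refine (Complex.abs_re_le_norm _).trans ((norm_integral_le_integral_norm _).trans ?_)
  simp only [hn]
  exact setIntegral_mono_set hi.norm.integrableOn
    (Filter.Eventually.of_forall fun t => norm_nonneg _) hA.eventuallyLE

lemma abs_thetaTrunc_sub_le (hψ : Integrable ψ) (hg : Integrable g)
    (hi : Integrable (fun x => ft ψ x * ft g x)) {j m : ℕ} (hmj : m ≤ j) :
    |thetaTrunc ψ g j - thetaTrunc ψ g m| ≤ biasBound ψ g m := by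
  rw [thetaTrunc_sub hψ hg hmj]
  refine abs_setIntegral_le_biasBound hi fun t ht => ?_
  have := ht.1
  rwa [min_eq_right hmj] at this

/-- By Parseval the target is the untruncated integral, so the bias is the integral over the
complement of the band. -/
lemma abs_thetaTrunc_sub_theta_le (hψ : Integrable ψ) (hψ' : Integrable (ft ψ))
    (hg : Integrable g) (hi : Integrable (fun x => ft ψ x * ft g x)) (m : ℕ) :
    |thetaTrunc ψ g m - theta ψ g| ≤ biasBound ψ g m := by
  have hi' : Integrable (fun x => ft ψ (-x) * ft g x) := by
    refine hi.mono (Continuous.aestronglyMeasurable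
      (((continuous_ft hψ).comp continuous_neg).mul (continuous_ft hg)))
      (Filter.Eventually.of_forall fun t => ?_)
    rw [norm_mul, norm_mul, norm_ft_neg]
  have h1 : theta ψ g = (1 / (2 * Real.pi)) * (∫ t, ft ψ (-t) * ft g t).re := by
    have := congrArg Complex.re (integral_mul_eq_integral_ft hψ hψ' hg)
    rwa [Complex.ofReal_re, Complex.re_ofReal_mul] at this
  rw [abs_sub_comm, h1, thetaTrunc, ← mul_sub, ← Complex.sub_re,
    ← setIntegral_compl₀ (measurableSet_band m).nullMeasurableSet hi']
  refine abs_setIntegral_le_biasBound hi fun t ht => ?_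
  exact (not_le.1 (show ¬ |t| ≤ Real.pi * m from ht)).le

/-- The noise part of one summand of `θ̂_j - θ̂_m`. -/
def noiseKernel (ψ f : ℝ → ℝ) (n : ℕ) (A : Set ℝ) (x e : ℝ) : ℝ :=
  (1 / n : ℝ) * (trig (ratio ψ f) A (x + e) - trig (fun t => ft ψ (-t)) A x)

/-- Averaging over the noise multiplies the ratio by `f^*` and leaves the `ψ^*` kernel, so the
difference is centred for each fixed state. Its variance is at most the uncentred second moment. -/
lemma Regular.noiseKernel_centred (h : Regular ψ f) {ν : Measure ℝ} [IsProbabilityMeasure ν]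
    (hf : IsDensityOf f ν) {n j m : ℕ} (hn : 0 < n) (hmj : m ≤ j) :
    CentredNoise ν (noiseKernel ψ f n (annulus j m)) (2 * cConst ψ f n j m)
      ((1 / (2 * Real.pi * n)) ^ 2 * (minTerm ψ f j m).toReal) := by
  have hn' : (0 : ℝ) < n := by exact_mod_cast hn
  set A := annulus j m with hA
  set B : ℝ := (1 / (2 * Real.pi)) * ∫ t in A, ‖ratio ψ f t‖ with hB
  have hhA : IntegrableOn (ratio ψ f) A :=
    (integrableOn_band h.continuous_ratio j).mono_set (annulus_subset_band hmj)
  have hψA : IntegrableOn (fun t => ft ψ (-t)) A :=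
    (integrableOn_band ((continuous_ft h.integrable_psi).comp continuous_neg) j).mono_set
      (annulus_subset_band hmj)
  have hmul : (fun t => ratio ψ f t * ft f t) = fun t => ft ψ (-t) := by
    ext t
    rw [ratio, div_mul_cancel₀ _ (h.ft_ne_zero t)]
  have hmean : ∀ x, ∫ e, trig (ratio ψ f) A (x + e) ∂ν = trig (fun t => ft ψ (-t)) A x := by
    intro x
    rw [integral_trig_add (hf.integral_cexp) hhA x, hmul]
  have hb1 : ∀ z, |trig (ratio ψ f) A z| ≤ B := abs_trig_le _ _
  -- The state kernel is a noise average of the first kernel and inherits its bound; the two copies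
  -- of `B` give the factor `2` of `cConst`.
  have hb2 : ∀ x, |trig (fun t => ft ψ (-t)) A x| ≤ B := fun x => by
    rw [← hmean]; exact abs_integral_le_of_abs_le fun e => hb1 _
  have hc1 := continuous_trig hhA
  have hc2 := continuous_trig hψA
  have hi1 : ∀ x, Integrable (fun e => trig (ratio ψ f) A (x + e)) ν := fun x =>
    Integrable.of_bound (hc1.comp (by fun_prop)).aestronglyMeasurable B
      (Filter.Eventually.of_forall fun e => hb1 _)
  have hi2 : ∀ x, Integrable (fun e => trig (ratio ψ f) A (x + e) ^ 2) ν := fun x =>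
    Integrable.of_bound ((hc1.comp (by fun_prop)).pow 2).aestronglyMeasurable (B ^ 2)
      (Filter.Eventually.of_forall fun e => by
        rw [norm_pow]; exact pow_le_pow_left₀ (norm_nonneg _) (hb1 _) 2)
  have hcB : 2 * cConst ψ f n j m = (1 / n : ℝ) * (B + B) := by
    rw [cConst, hB]
    simp only [norm_ratio]
    field_simp
    ring
  refine ⟨?_, fun x e => ?_, fun x => ?_, fun x => ?_⟩
  · refine Continuous.measurable ?_
    exact continuous_const.mul ((hc1.comp (by fun_prop)).sub (hc2.comp (by fun_prop)))
  · rw [hcB, noiseKernel, abs_mul, abs_of_pos (a := (1 / n : ℝ)) (by positivity)]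
    gcongr
    exact (abs_sub _ _).trans (add_le_add (hb1 _) (hb2 _))
  · simp only [noiseKernel]
    rw [integral_const_mul, integral_sub (hi1 x) (integrable_const _), hmean]
    simp
  · set w := trig (fun t => ft ψ (-t)) A x with hw
    have hV := integral_trig_add_sq_le (hf.integral_cexp) (continuous_ft h.integrable_f).measurable
      h.continuous_ratio.measurable hhA x
    simp only [enorm_ratio] at hV
    have e1 : ∀ e, noiseKernel ψ f n A x e ^ 2 = (1 / n : ℝ) ^ 2 *
        (trig (ratio ψ f) A (x + e) ^ 2 - ((2 * w) * trig (ratio ψ f) A (x + e) - w ^ 2)) := by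
      intro e; rw [noiseKernel]; ring
    have i3 : Integrable (fun e => (2 * w) * trig (ratio ψ f) A (x + e) - w ^ 2) ν :=
      ((hi1 x).const_mul _).sub (integrable_const _)
    simp only [e1]
    rw [integral_const_mul, integral_sub (hi2 x) i3,
      integral_sub ((hi1 x).const_mul _) (integrable_const _), integral_const_mul, hmean]
    calc (1 / n : ℝ) ^ 2 * (∫ e, trig (ratio ψ f) A (x + e) ^ 2 ∂ν
          - (2 * w * w - ∫ _, w ^ 2 ∂ν))
        ≤ (1 / n : ℝ) ^ 2 * ∫ e, trig (ratio ψ f) A (x + e) ^ 2 ∂ν := by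
          gcongr
          simp
          nlinarith [sq_nonneg w]
      _ ≤ (1 / n : ℝ) ^ 2 * ((1 / (2 * Real.pi)) ^ 2 * (minTerm ψ f j m).toReal) := by
          gcongr
          exact hV
      _ = _ := by field_simp

/-! ### Variance and sup-norm terms -/

lemma Regular.lintegral_ratio_ne_top (h : Regular ψ f) {j m : ℕ} (hmj : m ≤ j) :
    ∫⁻ x in annulus j m, ‖ft ψ x / ft f x‖ₑ ≠ ⊤ := by
  have := ((integrableOn_band h.continuous_ratio j).mono_set (annulus_subset_band hmj)).2
  simpa only [HasFiniteIntegral, enorm_ratio] using this.ne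

lemma annulus_comm (j m : ℕ) : annulus j m = annulus m j := by
  simp only [annulus, min_comm, max_comm]

lemma minTerm_mono {j m : ℕ} (hmj : m ≤ j) : minTerm ψ f j m ≤ minTerm ψ f 0 j := by
  have hsub : annulus j m ⊆ annulus 0 j := by
    rw [annulus_zero]; exact annulus_subset_band hmj
  unfold minTerm
  gcongr

lemma Regular.minTerm_ne_top (h : Regular ψ f) (j : ℕ) : minTerm ψ f 0 j ≠ ⊤ := by
  refine ne_top_of_le_ne_top (ENNReal.pow_ne_top (n := 2) ?_) (min_le_right _ _)
  rw [annulus_comm]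
  exact h.lintegral_ratio_ne_top (Nat.zero_le j)

lemma sigmaSqMix_eq (n j m : ℕ) :
    sigmaSqMix ψ f n j m = 2 * ((1 / (2 * Real.pi * n)) * (minTerm ψ f j m).toReal) := rfl

lemma Regular.pairMono_sigmaSqMix (h : Regular ψ f) (n : ℕ) :
    PairMono (sigmaSqMix ψ f n) where
  nonneg j m := by rw [sigmaSqMix_eq]; positivity
  le_zero_left j m hmj := by
    rw [sigmaSqMix_eq, sigmaSqMix_eq]
    gcongr
    · exact h.minTerm_ne_top j
    · exact minTerm_mono hmj
  diag j := by
    rw [sigmaSqMix_eq, minTerm, Measure.restrict_eq_zero.2 (volume_annulus_self j)]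
    simp

lemma Regular.pairMono_cMix (h : Regular ψ f) {c : ℝ} (hc : 0 < c) (n : ℕ) :
    PairMono (cMix ψ f c n) where
  nonneg j m := by
    have h1 : 0 ≤ ∫ x in annulus j m, ‖ft ψ x / ft f x‖ := integral_nonneg fun t => norm_nonneg _
    have h2 := Real.log_natCast_nonneg n
    rw [cMix, cConst]
    positivity
  le_zero_left j m hmj := by
    have h2 := Real.log_natCast_nonneg n
    have hsub : annulus j m ⊆ annulus 0 j := by
      rw [annulus_zero]; exact annulus_subset_band hmj
    have hi : IntegrableOn (fun x => ‖ft ψ x / ft f x‖) (annulus 0 j) := by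
      rw [annulus_zero]
      have := (integrableOn_band h.continuous_ratio j).norm
      simp only [norm_ratio] at this
      exact this
    simp only [cMix, cConst]
    gcongr
    exact Filter.Eventually.of_forall fun t => norm_nonneg _
  diag j := by
    rw [cMix, cConst, Measure.restrict_eq_zero.2 (volume_annulus_self j)]
    simp

/-- Only finitely many models have a variance term below a given level. -/
lemma Regular.finite_minTerm_lt (h : Regular ψ f)
    (h1 : (∫⁻ x, ‖ft ψ x / ft f x‖ₑ) = ⊤) (h2 : (∫⁻ x, ‖ft ψ x / ft f x‖ₑ ^ 2) = ⊤) (L : ℝ) :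
    {j : ℕ | (minTerm ψ f 0 j).toReal < L}.Finite := by
  have hmono : Monotone band := fun m j h => band_subset_band h
  have hunion : ⋃ j, band j = Set.univ := by
    refine Set.eq_univ_of_forall fun t => Set.mem_iUnion.2 ?_
    obtain ⟨j, hj⟩ := exists_nat_ge |t|
    refine ⟨j, hj.trans ?_⟩
    exact le_mul_of_one_le_left (Nat.cast_nonneg j) (by linarith [Real.pi_gt_three])
  have htend : ∀ F : ℝ → ENNReal, (∫⁻ x, F x) = ⊤ →
      Filter.Tendsto (fun j => ∫⁻ x in annulus 0 j, F x) Filter.atTop (nhds ⊤) := by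
    intro F hF
    -- Continuity from below of the measure with density `F` along the increasing bands.
    have := tendsto_measure_iUnion_atTop (μ := volume.withDensity F) hmono
    rw [hunion, withDensity_apply _ MeasurableSet.univ, Measure.restrict_univ, hF] at this
    refine this.congr fun j => ?_
    simp only [Function.comp, annulus_zero]
    exact withDensity_apply _ (measurableSet_band j)
  -- Needed because `0 * ⊤ = 0` in `ENNReal`; it follows from the non-vanishing of `f^*`.
  have hC : Ceps f ≠ 0 := by
    intro h0
    rw [Ceps, lintegral_eq_zero_iff (continuous_ft h.integrable_f).measurable.enorm] at h0
    have : ∃ᵐ x : ℝ, True := by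
      simpa using NeZero.ne (volume : Measure ℝ)
    obtain ⟨x, _, hx⟩ := (this.and_eventually h0).exists
    exact h.ft_ne_zero x (enorm_eq_zero.1 hx)
  have t1 : Filter.Tendsto (fun j => Ceps f * ∫⁻ x in annulus 0 j, ‖ft ψ x / ft f x‖ₑ ^ 2)
      Filter.atTop (nhds ⊤) := by
    have := ENNReal.Tendsto.const_mul (a := Ceps f) (htend _ h2) (Or.inl ENNReal.top_ne_zero)
    rwa [ENNReal.mul_top hC] at this
  have t2 : Filter.Tendsto (fun j => (∫⁻ x in annulus 0 j, ‖ft ψ x / ft f x‖ₑ) ^ 2)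
      Filter.atTop (nhds ⊤) := by
    have := ((ENNReal.continuous_pow 2).tendsto ⊤).comp (htend _ h1)
    rwa [ENNReal.top_pow two_ne_zero] at this
  have t3 : Filter.Tendsto (fun j => minTerm ψ f 0 j) Filter.atTop (nhds ⊤) := by
    have := t1.min t2
    rwa [min_self] at this
  have hev := t3.eventually (lt_mem_nhds (ENNReal.ofReal_lt_top (r := L)))
  obtain ⟨N, hN⟩ := Filter.eventually_atTop.1 hev
  refine (Set.finite_Iio N).subset fun j hj => ?_
  by_contra hjN
  have h3 := hN j (not_lt.1 hjN)
  have h4 : minTerm ψ f 0 j < ENNReal.ofReal L := by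
    rw [← ENNReal.ofReal_toReal (h.minTerm_ne_top j)]
    refine (ENNReal.ofReal_lt_ofReal_iff_of_nonneg ENNReal.toReal_nonneg).2 hj
  exact absurd h3 (not_lt.2 h4.le)

end Kernel


/-! ### Expected excess of the noise terms -/

section Excess

variable {Ω : Type*} [MeasurableSpace Ω] {μ : Measure Ω} [IsProbabilityMeasure μ]
  {X ε : ℕ → Ω → ℝ} {ν : Measure ℝ} [IsProbabilityMeasure ν] {D : ℝ → ℝ → ℝ} {b v : ℝ}

lemma CentredNoise.integrable_max (hD : CentredNoise ν D b v)
    (hX : ∀ i, Measurable (X i)) (hε : ∀ i, Measurable (ε i)) (n : ℕ) (K : ℝ) :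
    Integrable (fun ω => max ((∑ k ∈ Finset.Icc 1 n, D (X k ω) (ε k ω)) ^ 2 - K) 0) μ :=
  ((hD.integrable_sq hX hε n).sub (integrable_const K)).sup (integrable_const 0)

/-- Absorbs the factor `x` in front of `κ²` into the spare half of the exponent `(3/2) x`. -/
lemma mul_exp_le_exp_neg {x : ℝ} (hx : 0 ≤ x) :
    x * Real.exp (-(3 / 2) * x) ≤ Real.exp (-x) := by
  have h1 : x ≤ Real.exp (x / 2) := by
    have := Real.quadratic_le_exp_of_nonneg (x := x / 2) (by linarith)
    nlinarith [sq_nonneg (x / 2 - 1)]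
  calc x * Real.exp (-(3 / 2) * x) ≤ Real.exp (x / 2) * Real.exp (-(3 / 2) * x) := by gcongr
    _ = Real.exp (-x) := by rw [← Real.exp_add]; congr 1; ring

/-- Expected excess of a noise sum for weights at least one. -/
lemma CentredNoise.integral_excess_le_of_one_le (hD : CentredNoise ν D b v)
    (hX : ∀ i, Measurable (X i)) (hε : ∀ i, Measurable (ε i)) (hind : NoiseIndep μ X ε)
    (hν : ∀ i, μ.map (ε i) = ν) (n : ℕ) {x σ κ : ℝ} (hx : 1 ≤ x) (hσ : 0 ≤ σ)
    (hκ : 2 * b ≤ κ) (hv : 25 * (n * v) ≤ 2 * σ) :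
    ∫ ω, max ((∑ k ∈ Finset.Icc 1 n, D (X k ω) (ε k ω)) ^ 2
        - 2 * (x * σ + x ^ 2 * κ ^ 2)) 0 ∂μ
      ≤ 6 * (σ + x * κ ^ 2) * Real.exp (-(3 / 2) * x) := by
  have hb := hD.b_nonneg
  have hx0 : 0 < x := by linarith
  have hK0 : 0 ≤ 2 * (x * σ + x ^ 2 * κ ^ 2) := by positivity
  -- The deviation level whose square is the half correction. If it is zero then `b = 0` and the sum
  -- vanishes identically.
  obtain ⟨τ, hτ0, hτsq⟩ : ∃ τ : ℝ, 0 ≤ τ ∧ τ ^ 2 = 2 * (x * σ + x ^ 2 * κ ^ 2) :=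
    ⟨_, Real.sqrt_nonneg _, Real.sq_sqrt hK0⟩
  have h4 : 0 ≤ x * σ := by positivity
  have h5 : 0 ≤ x ^ 2 * κ ^ 2 := by positivity
  have hxb : 2 * x * b ≤ τ := by
    refine abs_le_of_sq_le_sq' ?_ hτ0 |>.2
    have h1 : (2 * b) ^ 2 ≤ κ ^ 2 := pow_le_pow_left₀ (by positivity) hκ 2
    have h2 : x ^ 2 * (2 * b) ^ 2 ≤ x ^ 2 * κ ^ 2 := by gcongr
    rw [hτsq]
    linarith
  rw [← hτsq]
  rcases hτ0.eq_or_lt with h0 | h0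
  · have hb0 : b = 0 := by
      have : 2 * x * b ≤ 0 := by linarith
      exact le_antisymm (by nlinarith) hb
    have hzero : ∀ ω, max ((∑ k ∈ Finset.Icc 1 n, D (X k ω) (ε k ω)) ^ 2 - τ ^ 2) 0 = 0 := by
      intro ω
      have h1 := hD.abs_sum_le (X := X) (ε := ε) n ω
      rw [hb0, mul_zero, abs_nonpos_iff] at h1
      rw [h1, ← h0]
      simp
    refine (integral_eq_zero_of_ae (Filter.Eventually.of_forall hzero)).le.trans ?_
    positivity
  · have hτv : 25 * x * (n * v) ≤ τ ^ 2 := by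
      have h6 : x * (25 * (n * v)) ≤ x * (2 * σ) := by gcongr
      rw [hτsq]
      linarith
    refine (hD.integral_max_sq_sub_le hX hε hind hν n hx h0 hτv hxb).trans_eq ?_
    rw [hτsq]
    field_simp
    ring

/-- Weights above this level make the excess vanish when `ln n < 2c`. -/
def weightBound (c : ℝ) : ℝ := Real.exp (2 * c) * c / Real.log 2

/-- Expected excess of a noise sum over its penalty; the indicator term only occurs for sample
sizes with `ln n < 2c` and small variance terms. -/
lemma CentredNoise.integral_excess_le (hD : CentredNoise ν D b v)
    (hX : ∀ i, Measurable (X i)) (hε : ∀ i, Measurable (ε i)) (hind : NoiseIndep μ X ε)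
    (hν : ∀ i, μ.map (ε i) = ν) {n : ℕ} (hn : 2 ≤ n) {c x σ σ₀ : ℝ} (hc : 0 < c) (hx : 0 < x)
    (hσ : 4 * Real.pi * (n * v) = σ) (hσ₀ : σ ≤ σ₀) :
    ∫ ω, max ((∑ k ∈ Finset.Icc 1 n, D (X k ω) (ε k ω)) ^ 2
        - 2 * (x * σ + x ^ 2 * (b * Real.log n / c) ^ 2)) 0 ∂μ
      ≤ 6 * (Real.exp (-x) * (σ₀ + (b * Real.log n / c) ^ 2 + σ₀ ^ 2))
        + if Real.log n < 2 * c ∧ σ₀ < Real.exp (weightBound c)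
          then Real.exp (weightBound c) else 0 := by
  set κ := b * Real.log n / c with hκ
  set S : Ω → ℝ := fun ω => ∑ k ∈ Finset.Icc 1 n, D (X k ω) (ε k ω) with hS
  have hb := hD.b_nonneg
  have hv := hD.v_nonneg
  have hn' : (2 : ℝ) ≤ n := by exact_mod_cast hn
  have hlog2 : 0 < Real.log 2 := Real.log_pos (by norm_num)
  have hlog : Real.log 2 ≤ Real.log n := Real.log_le_log (by norm_num) hn'
  have hκ0 : 0 ≤ κ := by
    have : 0 ≤ Real.log n := by linarith
    rw [hκ]; positivity
  have hnv : 0 ≤ (n : ℝ) * v := by positivity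
  have hpi := Real.pi_gt_d2
  have hσ0 : 0 ≤ σ := by rw [← hσ]; positivity
  have hσ₀0 : 0 ≤ σ₀ := hσ0.trans hσ₀
  have hite : 0 ≤ if Real.log n < 2 * c ∧ σ₀ < Real.exp (weightBound c)
          then Real.exp (weightBound c) else 0 := by
    split_ifs
    · exact (Real.exp_pos _).le
    · exact le_rfl
  have hK0 : 0 ≤ 2 * (x * σ + x ^ 2 * κ ^ 2) := by positivity
  -- Crude bound ignoring the correction, used whenever the exponential factor is harmless.
  have hvar : ∫ ω, max (S ω ^ 2 - 2 * (x * σ + x ^ 2 * κ ^ 2)) 0 ∂μ ≤ σ := by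
    calc ∫ ω, max (S ω ^ 2 - 2 * (x * σ + x ^ 2 * κ ^ 2)) 0 ∂μ ≤ ∫ ω, S ω ^ 2 ∂μ := by
          refine integral_mono (hD.integrable_max hX hε n _) (hD.integrable_sq hX hε n) fun ω => ?_
          exact max_le (by linarith) (sq_nonneg _)
      _ ≤ 4 * (n * v) := hD.integral_sum_sq_le hX hε hind hν n
      _ ≤ σ := by rw [← hσ]; nlinarith
  by_cases hreg : Real.log n < 2 * c
  · rcases le_or_gt (weightBound c) x with hxl | hxl
    -- Here `n` is at most the exponential of `2c`, and `weightBound` is calibrated so that even the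
    -- deterministic bound `n b` on the sum is below `x κ`.
    · have hzero : ∀ ω, max (S ω ^ 2 - 2 * (x * σ + x ^ 2 * κ ^ 2)) 0 = 0 := by
        intro ω
        refine max_eq_right ?_
        have hnexp : (n : ℝ) ≤ Real.exp (2 * c) := by
          rw [← Real.log_le_iff_le_exp (by linarith)]; exact hreg.le
        have h1 : n * b ≤ x * κ := by
          calc n * b ≤ Real.exp (2 * c) * b := by gcongr
            _ = weightBound c * (b * Real.log 2 / c) := by
                rw [weightBound]; field_simp
            _ ≤ x * κ := by
                rw [hκ]
                gcongr
        have h2 : S ω ^ 2 ≤ (n * b) ^ 2 := by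
          rw [← sq_abs]
          exact pow_le_pow_left₀ (abs_nonneg _) (hD.abs_sum_le n ω) 2
        have h3 : (n * b) ^ 2 ≤ (x * κ) ^ 2 := pow_le_pow_left₀ (by positivity) h1 2
        have h4 : 0 ≤ x * σ := by positivity
        nlinarith [sq_nonneg (x * κ)]
      have : 0 ≤ 6 * (Real.exp (-x) * (σ₀ + κ ^ 2 + σ₀ ^ 2)) := by positivity
      exact (integral_eq_zero_of_ae (Filter.Eventually.of_forall hzero)).le.trans
        (add_nonneg this hite)
    -- For small weights, either `σ₀` is small and the exceptional term pays, or `σ₀ ≥ exp x` and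
    -- the term `exp (-x) σ₀²` dominates the variance. The square in `omegaSq` serves this case.
    · rcases lt_or_ge σ₀ (Real.exp (weightBound c)) with hs | hs
      · rw [if_pos ⟨hreg, hs⟩]
        have : 0 ≤ 6 * (Real.exp (-x) * (σ₀ + κ ^ 2 + σ₀ ^ 2)) := by positivity
        linarith
      · have h1 : 1 ≤ Real.exp (-x) * σ₀ := by
          calc (1 : ℝ) = Real.exp (-x) * Real.exp x := by rw [← Real.exp_add]; simp
            _ ≤ Real.exp (-x) * σ₀ := by
                gcongr
                exact (Real.exp_le_exp.2 hxl.le).trans hs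
        have h2 : σ₀ ≤ Real.exp (-x) * σ₀ ^ 2 := by nlinarith
        have h3 : 0 ≤ Real.exp (-x) * (σ₀ + κ ^ 2) := by positivity
        nlinarith
  · rw [not_lt] at hreg
    -- Below `1`, `exp (-x) ≥ 1/3`, so the crude variance bound suffices; from `1` on, Bernstein
    -- applies because `ln n ≥ 2c` means `2 b ≤ κ`.
    rcases lt_or_ge x 1 with hx1 | hx1
    · have h1 : 1 / 3 ≤ Real.exp (-x) := by
        have h2 : Real.exp (-1) ≤ Real.exp (-x) := Real.exp_le_exp.2 (by linarith)
        have h3 := Real.exp_one_lt_d9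
        have h4 : Real.exp (-1) * Real.exp 1 = 1 := by rw [← Real.exp_add]; simp
        have h5 : 1 / 3 ≤ Real.exp (-1) := by nlinarith [Real.exp_pos (-1)]
        linarith
      have h3 : 0 ≤ Real.exp (-x) * (κ ^ 2 + σ₀ ^ 2) := by positivity
      nlinarith
    · have hκb : 2 * b ≤ κ := by
        rw [hκ, le_div_iff₀ hc]
        nlinarith
      -- The variance condition holds since `2 σ = 8 π n v` and `8 π > 25`.
      have hmain := hD.integral_excess_le_of_one_le hX hε hind hν n hx1 hσ0 hκb
        (by rw [← hσ]; nlinarith)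
      have hxe := mul_exp_le_exp_neg (zero_le_one.trans hx1)
      have hee : Real.exp (-(3 / 2) * x) ≤ Real.exp (-x) := Real.exp_le_exp.2 (by linarith)
      have h1 : σ * Real.exp (-(3 / 2) * x) ≤ σ₀ * Real.exp (-x) := by gcongr
      have h2 : κ ^ 2 * (x * Real.exp (-(3 / 2) * x)) ≤ κ ^ 2 * Real.exp (-x) := by gcongr
      have h3 : 0 ≤ Real.exp (-x) * σ₀ ^ 2 := by positivity
      linarith

end Excess

/-! ### The risk bound -/

section Risk

variable {ψ f g : ℝ → ℝ} {c : ℝ}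

/-- Remainder attached to model `j`; it vanishes for all but finitely many models. -/
def excessRem (ψ f : ℝ → ℝ) (c : ℝ) (j : ℕ) : ℝ :=
  if (minTerm ψ f 0 j).toReal < Real.pi * Real.exp (weightBound c + 2 * c)
    then Real.exp (weightBound c + 2 * c) else 0

lemma excessRem_nonneg (j : ℕ) : 0 ≤ excessRem ψ f c j := by
  rw [excessRem]
  split_ifs
  · exact (Real.exp_pos _).le
  · exact le_rfl

/-- The two divergent integrals leave only finitely many nonzero remainders, so their sum is bounded
uniformly in `M`. The bound depends only on `ψ`, `f` and `c`, as `C'` requires. -/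
lemma Regular.exists_sum_excessRem_le (h : Regular ψ f)
    (h1 : (∫⁻ x, ‖ft ψ x / ft f x‖ₑ) = ⊤) (h2 : (∫⁻ x, ‖ft ψ x / ft f x‖ₑ ^ 2) = ⊤) (c : ℝ) :
    ∃ r : ℝ, 0 ≤ r ∧ ∀ M : Finset ℕ, ∑ j ∈ M, excessRem ψ f c j ≤ r := by
  have hfin := h.finite_minTerm_lt h1 h2 (Real.pi * Real.exp (weightBound c + 2 * c))
  refine ⟨∑ j ∈ hfin.toFinset, excessRem ψ f c j,
    Finset.sum_nonneg fun j _ => excessRem_nonneg j, fun M => ?_⟩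
  rw [← Finset.sum_filter_ne_zero (s := M)]
  refine Finset.sum_le_sum_of_subset_of_nonneg (fun j hj => ?_) fun j _ _ => excessRem_nonneg j
  rw [Finset.mem_filter, excessRem] at hj
  rw [Set.Finite.mem_toFinset]
  by_contra hlt
  exact hj.2 (if_neg hlt)

variable {Ω : Type*} [MeasurableSpace Ω] {μ : Measure Ω} [IsProbabilityMeasure μ]
  {X ε : ℕ → Ω → ℝ}

/-- The noise part of `θ̂_j - θ̂_m`. -/
def noiseSum (ψ f : ℝ → ℝ) (X ε : ℕ → Ω → ℝ) (n j m : ℕ) (ω : Ω) : ℝ :=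
  ∑ k ∈ Finset.Icc 1 n, noiseKernel ψ f n (annulus j m) (X k ω) (ε k ω)

/-- The excess of the noise part of `θ̂_j - θ̂_m` over half of the bias correction. -/
def noiseExcess (ψ f : ℝ → ℝ) (c : ℝ) (x : ℕ → ℝ) (X ε : ℕ → Ω → ℝ) (n j m : ℕ) (ω : Ω) : ℝ :=
  max (noiseSum ψ f X ε n j m ω ^ 2
    - halfCorr x (sigmaSqMix ψ f n) (cMix ψ f c n) j m) 0

lemma Regular.integrable_noiseExcess (h : Regular ψ f) (hM : Model μ X ε f g) {n : ℕ} (hn : 2 ≤ n)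
    (x : ℕ → ℝ) {j m : ℕ} (hmj : m ≤ j) : Integrable (noiseExcess ψ f c x X ε n j m) μ := by
  have : IsProbabilityMeasure (μ.map (ε 0)) :=
    Measure.isProbabilityMeasure_map (hM.measurable_ε 0).aemeasurable
  exact (h.noiseKernel_centred (hM.density_ε 0) (by omega : 0 < n) hmj).integrable_max
    hM.measurable_X hM.measurable_ε n _

/-- The terms of the pair `(j, m)` are replaced by the larger ones of `(0, j)`, so the bound no
longer depends on `m`. -/
lemma Regular.integral_noiseExcess_le (h : Regular ψ f) (hM : Model μ X ε f g)
    (hind : NoiseIndep μ X ε) (hc : 0 < c) {n : ℕ} (hn : 2 ≤ n) {x : ℕ → ℝ} {j m : ℕ}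
    (hx : 0 < x j) (hmj : m ≤ j) :
    ∫ ω, noiseExcess ψ f c x X ε n j m ω ∂μ
      ≤ 6 * (Real.exp (-x j) * omegaSq (sigmaSqMix ψ f n) (cMix ψ f c n) j)
        + excessRem ψ f c j / n := by
  have : IsProbabilityMeasure (μ.map (ε 0)) :=
    Measure.isProbabilityMeasure_map (hM.measurable_ε 0).aemeasurable
  have hn0 : (0 : ℝ) < n := by exact_mod_cast (by omega : 0 < n)
  have hs := h.pairMono_sigmaSqMix n
  have hd := h.pairMono_cMix hc n
  have hlaw : ∀ i, μ.map (ε i) = μ.map (ε 0) := fun i => by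
    rw [(hM.density_ε i).law_eq, (hM.density_ε 0).law_eq]
  have hexc := (h.noiseKernel_centred (hM.density_ε 0) (by omega : 0 < n) hmj).integral_excess_le
    (σ := sigmaSqMix ψ f n j m) hM.measurable_X hM.measurable_ε hind hlaw hn hc hx
    (by rw [sigmaSqMix_eq]; field_simp; ring) (hs.le_zero_left j m hmj)
  refine hexc.trans (add_le_add ?_ ?_)
  · gcongr
    have h1 : 2 * cConst ψ f n j m * Real.log n / c = cMix ψ f c n j m := rfl
    rw [h1, omegaSq]
    set w := max (sigmaSqMix ψ f n 0 j) (cMix ψ f c n 0 j) with hw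
    have h2 : sigmaSqMix ψ f n 0 j ≤ w := le_max_left _ _
    have h3 : cMix ψ f c n j m ≤ w := (hd.le_zero_left j m hmj).trans (le_max_right _ _)
    have h4 : sigmaSqMix ψ f n 0 j ^ 2 ≤ w ^ 2 := pow_le_pow_left₀ (hs.nonneg 0 j) h2 2
    have h5 : cMix ψ f c n j m ^ 2 ≤ w ^ 2 := pow_le_pow_left₀ (hd.nonneg j m) h3 2
    linarith
  -- The exceptional term occurs only for `n < exp (2c)`; the extra `2c` in the exponent of
  -- `excessRem` turns it into a multiple of `1/n`.
  · split_ifs with hcond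
    · obtain ⟨hlog, hsig⟩ := hcond
      have hnexp : (n : ℝ) < Real.exp (2 * c) := (Real.log_lt_iff_lt_exp hn0).1 hlog
      have hlt : (minTerm ψ f 0 j).toReal < Real.pi * Real.exp (weightBound c + 2 * c) := by
        have h1 : (minTerm ψ f 0 j).toReal = Real.pi * (sigmaSqMix ψ f n 0 j * n) := by
          rw [sigmaSqMix_eq]; field_simp
        rw [h1, Real.exp_add]
        have := hs.nonneg 0 j
        gcongr
      rw [excessRem, if_pos hlt, Real.exp_add, le_div_iff₀ hn0]
      gcongr
    · exact div_nonneg (excessRem_nonneg j) hn0.le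

/-- Decomposition of `θ̂_j - θ̂_m` into noise part, target and a uniformly small remainder. -/
lemma Regular.abs_thetaHat_sub_sub_le (h : Regular ψ f) (hψ : Integrable (ft ψ))
    (hX : ∀ i, Measurable (X i)) (hgi : Integrable g) (hg : ∀ t, ‖ft g t‖ ≤ 1) {n : ℕ}
    (hn : 0 < n) {j m : ℕ} (hmj : m ≤ j) (ω : Ω) :
    |thetaHat ψ f n j (fun i => obs X ε i ω) - thetaHat ψ f n m (fun i => obs X ε i ω)
        - (thetaTrunc ψ g j - thetaTrunc ψ g m) - noiseSum ψ f X ε n j m ω|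
      ≤ empLoss ψ X g n ω := by
  have key := abs_sum_trig_sub_le hψ hX hgi hg hn (annulus j m) ω
  rw [h.thetaHat_sub n hmj, thetaTrunc_sub h.integrable_psi hgi hmj, noiseSum]
  simp only [noiseKernel]
  rw [← Finset.mul_sum, Finset.sum_sub_distrib]
  convert key using 2
  simp only [obs]
  ring

lemma measurable_thetaHat (h : Regular ψ f) (hX : ∀ i, Measurable (X i))
    (hε : ∀ i, Measurable (ε i)) (n m : ℕ) :
    Measurable fun ω => thetaHat ψ f n m (fun i => obs X ε i ω) := by
  simp only [thetaHat_eq]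
  refine (Finset.measurable_sum _ fun k _ => ?_).const_mul _
  exact (continuous_trig (integrableOn_band h.continuous_ratio m)).measurable.comp
    ((hX k).add (hε k))

/-- Risk bound of the adaptive estimator at a fixed competitor. -/
theorem Regular.risk_le (h : Regular ψ f) (hψ : Integrable (ft ψ)) (hM : Model μ X ε f g)
    (hst : Standing ψ f g) (hind : NoiseIndep μ X ε) (hcov : CovDecay μ X c) (hc : 0 < c) {a : ℝ}
    (ha : 0 < a) {n : ℕ} (hn : 2 ≤ n) {M : Finset ℕ} {x : ℕ → ℝ} (hx : ∀ m ∈ M, 0 < x m)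
    {m : ℕ} (hm : m ∈ M) {r : ℝ} (hr : ∑ j ∈ M, excessRem ψ f c j ≤ r) :
    Integrable (fun ω => (adaptiveEstimator ψ f c a n M x (fun i => obs X ε i ω)
      - theta ψ g) ^ 2) μ ∧
    ∫ ω, (adaptiveEstimator ψ f c a n M x (fun i => obs X ε i ω) - theta ψ g) ^ 2 ∂μ
      ≤ (18 + 4 * a + 8 / a) * (biasBound ψ g m ^ 2
          + pen a x (sigmaSqMix ψ f n) (cMix ψ f c n) m
        + 12 * ∑ j ∈ M, Real.exp (-x j) * omegaSq (sigmaSqMix ψ f n) (cMix ψ f c n) j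
        + (2 * r + (∫ t, ‖ft ψ t‖) ^ 2 * (8 * (1 - Real.exp (-c))⁻¹) + 1) / n) := by
  have hn0 : 0 < n := by omega
  have hn' : (0 : ℝ) < n := by exact_mod_cast hn0
  have hprob : IsProbabilityMeasure (μ.map (X 0)) :=
    Measure.isProbabilityMeasure_map (hM.measurable_X 0).aemeasurable
  have hgi : Integrable g := (hM.density_X 0).integrable
  have hg1 := norm_ft_le_one (hM.density_X 0)
  have hs := h.pairMono_sigmaSqMix n
  have hd := h.pairMono_cMix hc n
  set s := sigmaSqMix ψ f n with hs_def
  set d := cMix ψ f c n with hd_def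
  set C₀ := 18 + 4 * a + 8 / a with hC₀
  have hC₀0 : 0 < C₀ := by positivity
  set T : Ω → ℕ → ℝ := fun ω j => thetaHat ψ f n j (fun i => obs X ε i ω) with hT
  -- A sum of positive parts dominates their supremum over the models above `m`.
  set Q : Ω → ℝ := fun ω => ∑ j ∈ M with m ≤ j, noiseExcess ψ f c x X ε n j m ω with hQ
  set N₀ : Ω → ℝ := noiseExcess ψ f c x X ε n m 0 with hN₀
  set R : Ω → ℝ := empLoss ψ X g n with hR
  have hTm : ∀ j, Measurable fun ω => T ω j := fun j =>
    measurable_thetaHat h hM.measurable_X hM.measurable_ε n j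
  have hmeas : Measurable fun ω =>
      (adaptiveEstimator ψ f c a n M x (fun i => obs X ε i ω) - theta ψ g) ^ 2 :=
    ((measurable_selected hTm).sub_const _).pow_const 2
  have hpt : ∀ ω, (adaptiveEstimator ψ f c a n M x (fun i => obs X ε i ω) - theta ψ g) ^ 2
      ≤ C₀ * (biasBound ψ g m ^ 2 + pen a x s d m + Q ω + N₀ ω + R ω ^ 2 + 1 / n) := by
    intro ω
    refine sq_selected_sub_le (T := T ω) (t := thetaTrunc ψ g)
      (S := fun j => noiseSum ψ f X ε n j m ω) (S₀ := noiseSum ψ f X ε n m 0 ω)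
      ha hn0 hs hd (fun j hj => (hx j hj).le) hm
      (abs_thetaTrunc_sub_theta_le h.integrable_psi hψ hgi hst.integrable_ft_mul m)
      (fun j _ hmj => abs_thetaTrunc_sub_le h.integrable_psi hgi hst.integrable_ft_mul hmj)
      (fun j _ hmj => h.abs_thetaHat_sub_sub_le hψ hM.measurable_X hgi hg1 hn0 hmj ω)
      (fun j hj hmj => ?_) (Finset.sum_nonneg fun j _ => le_max_right _ _) ?_
      (le_max_left _ _) (le_max_right _ _)
    · refine (le_max_left _ 0).trans ?_
      exact Finset.single_le_sum (f := fun j => noiseExcess ψ f c x X ε n j m ω)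
        (fun i _ => le_max_right _ _) (Finset.mem_filter.2 ⟨hj, hmj⟩)
    · have := h.abs_thetaHat_sub_sub_le (ε := ε) hψ hM.measurable_X hgi hg1 hn0
        (Nat.zero_le m) ω
      rwa [thetaHat_zero, thetaTrunc_zero, sub_zero, sub_zero] at this
  have iQ : Integrable Q μ := integrable_finsetSum _ fun j hj =>
    h.integrable_noiseExcess hM hn x (Finset.mem_filter.1 hj).2
  have iN : Integrable N₀ μ := h.integrable_noiseExcess hM hn x (Nat.zero_le m)
  have iR : Integrable (fun ω => R ω ^ 2) μ :=
    integrable_empLoss_sq h.integrable_psi hψ hM.measurable_X hgi hg1 hn0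
  have i1 : Integrable (fun ω => biasBound ψ g m ^ 2 + pen a x s d m + Q ω) μ :=
    (integrable_const _).add iQ
  have i2 : Integrable (fun ω => biasBound ψ g m ^ 2 + pen a x s d m + Q ω + N₀ ω) μ := i1.add iN
  have i3 : Integrable (fun ω => biasBound ψ g m ^ 2 + pen a x s d m + Q ω + N₀ ω + R ω ^ 2) μ :=
    i2.add iR
  have i4 : Integrable (fun ω => C₀ * (biasBound ψ g m ^ 2 + pen a x s d m + Q ω + N₀ ω
      + R ω ^ 2 + 1 / n)) μ := (i3.add (integrable_const _)).const_mul _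
  have iE : Integrable (fun ω => (adaptiveEstimator ψ f c a n M x (fun i => obs X ε i ω)
      - theta ψ g) ^ 2) μ :=
    i4.mono' hmeas.aestronglyMeasurable (Filter.Eventually.of_forall fun ω => by
      rw [Real.norm_of_nonneg (sq_nonneg _)]; exact hpt ω)
  refine ⟨iE, ?_⟩
  have hω : ∀ j ∈ M, 0 ≤ 6 * (Real.exp (-x j) * omegaSq s d j) + excessRem ψ f c j / n := by
    intro j _
    have h1 := excessRem_nonneg (ψ := ψ) (f := f) (c := c) j
    have h2 : 0 ≤ max (s 0 j) (d 0 j) := (hs.nonneg 0 j).trans (le_max_left _ _)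
    rw [omegaSq]
    positivity
  set W₀ := ∑ j ∈ M, Real.exp (-x j) * omegaSq s d j with hW
  have hsum : ∑ j ∈ M, (6 * (Real.exp (-x j) * omegaSq s d j) + excessRem ψ f c j / n)
      ≤ 6 * W₀ + r / n := by
    rw [Finset.sum_add_distrib, ← Finset.mul_sum, ← Finset.sum_div]
    gcongr
  have eQ : ∫ ω, Q ω ∂μ ≤ 6 * W₀ + r / n := by
    refine le_trans ?_ hsum
    rw [hQ, integral_finsetSum _ fun j hj =>
      h.integrable_noiseExcess hM hn x (Finset.mem_filter.1 hj).2]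
    refine (Finset.sum_le_sum fun j hj => h.integral_noiseExcess_le hM hind hc hn
      (hx j (Finset.mem_filter.1 hj).1) (Finset.mem_filter.1 hj).2).trans ?_
    exact Finset.sum_le_sum_of_subset_of_nonneg (Finset.filter_subset _ _) fun j hj _ => hω j hj
  -- The excess at `m` against model `0` is bounded by one summand of the same sum. Together with
  -- `Q` it accounts for the factor `12`.
  have eN : ∫ ω, N₀ ω ∂μ ≤ 6 * W₀ + r / n :=
    ((h.integral_noiseExcess_le hM hind hc hn (hx m hm) (Nat.zero_le m)).trans
      (Finset.single_le_sum hω hm)).trans hsum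
  have eR := hcov.integral_empLoss_sq_le hM.measurable_X hc hM.density_X h.integrable_psi hψ hn0
  calc ∫ ω, (adaptiveEstimator ψ f c a n M x (fun i => obs X ε i ω) - theta ψ g) ^ 2 ∂μ
      ≤ ∫ ω, C₀ * (biasBound ψ g m ^ 2 + pen a x s d m + Q ω + N₀ ω + R ω ^ 2 + 1 / n) ∂μ :=
        integral_mono iE i4 hpt
    _ = C₀ * (biasBound ψ g m ^ 2 + pen a x s d m + (∫ ω, Q ω ∂μ) + (∫ ω, N₀ ω ∂μ)
          + (∫ ω, R ω ^ 2 ∂μ) + 1 / n) := by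
        rw [integral_const_mul, integral_add i3 (integrable_const _), integral_add i2 iR,
          integral_add i1 iN, integral_add (integrable_const _) iQ]
        simp
    _ ≤ C₀ * (biasBound ψ g m ^ 2 + pen a x s d m + (6 * W₀ + r / n) + (6 * W₀ + r / n)
          + (∫ t, ‖ft ψ t‖) ^ 2 * (8 * (1 - Real.exp (-c))⁻¹) / n + 1 / n) := by
        gcongr
    _ = _ := by ring

end Risk

end Deconv
end
-- The oracle inequality
theorem corollary3p1 :
    -- `C` depends on `a` only
    ∀ a : ℝ, 0 < a → ∃ C : ℝ, 0 < C ∧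
    ∀ (f ψ : ℝ → ℝ) (c : ℝ), 0 < c →
      Integrable (Deconv.ft ψ) →
      (∫⁻ x, ‖Deconv.ft ψ x / Deconv.ft f x‖ₑ) = ⊤ →
      (∫⁻ x, ‖Deconv.ft ψ x / Deconv.ft f x‖ₑ ^ 2) = ⊤ →
    -- `C'` depends neither on the law of the data nor on `n`, `𝓜` and the weights
    ∃ C' : ℝ, 0 < C' ∧
    ∀ (g : ℝ → ℝ), Deconv.Standing ψ f g →
    ∀ (Ω : Type*) [MeasurableSpace Ω] (μ : Measure Ω) [IsProbabilityMeasure μ]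
      (X ε : ℕ → Ω → ℝ), Deconv.Model μ X ε f g →
      (Deconv.ContextD1 μ X ε c ∨
        (Deconv.ContextD2 μ X ε c ∧
          ∃ κ₀ κ₁ γ α ρ C₁ C₂ B A R : ℝ,
            Deconv.NoiseSmooth f κ₀ κ₁ γ α ρ ∧ Deconv.FunctionalSmooth ψ C₁ C₂ B A R ∧
            (max B 1 < γ ∨ (0 < A ∧ 0 < ρ)))) →
    ∀ (n : ℕ), 2 ≤ n → ∀ (M : Finset ℕ), M.Nonempty →
    ∀ (x : ℕ → ℝ), (∀ m ∈ M, 0 < x m) →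
      Integrable (fun ω => (Deconv.adaptiveEstimator ψ f c a n M x
        (fun i => Deconv.obs X ε i ω) - Deconv.theta ψ g) ^ 2) μ ∧
      ∫ ω, (Deconv.adaptiveEstimator ψ f c a n M x
        (fun i => Deconv.obs X ε i ω) - Deconv.theta ψ g) ^ 2 ∂μ
      ≤ C * (⨅ m : M, (Deconv.biasBound ψ g m ^ 2
            + Deconv.pen a x (Deconv.sigmaSqMix ψ f n) (Deconv.cMix ψ f c n) m))
        + C * ∑ m ∈ M, Real.exp (-x m)
            * Deconv.omegaSq (Deconv.sigmaSqMix ψ f n) (Deconv.cMix ψ f c n) m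
        + C' / n := by
  intro a ha
  have hC₀ : 0 < 18 + 4 * a + 8 / a := by positivity
  refine ⟨12 * (18 + 4 * a + 8 / a), by positivity, ?_⟩
  intro f ψ c hc hψ h1 h2
  -- `C'` must be chosen before `g` and the model, so the regularity of the pair `ψ`, `f` is not yet
  -- available; when it fails, no model exists and any constant works.
  by_cases hreg : Deconv.Regular ψ f
  · obtain ⟨r, hr0, hr⟩ := hreg.exists_sum_excessRem_le h1 h2 c
    have hexp : Real.exp (-c) < 1 := by simpa using hc
    have hden : 0 < (1 - Real.exp (-c))⁻¹ := inv_pos.2 (by linarith)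
    refine ⟨(18 + 4 * a + 8 / a) * (2 * r + (∫ t, ‖Deconv.ft ψ t‖) ^ 2
      * (8 * (1 - Real.exp (-c))⁻¹) + 1), by positivity, ?_⟩
    intro g hst Ω _ μ _ X ε hM hctx n hn M hMne x hx
    have hind : Deconv.NoiseIndep μ X ε := by
      rcases hctx with h | h
      · exact h.noiseIndep hM
      · exact h.1.noiseIndep
    have hcov : Deconv.CovDecay μ X c := by
      rcases hctx with h | h
      · exact h.covDecay hM
      · exact h.1.covDecay hM
    have : Nonempty M := hMne.to_subtype
    -- The infimum over the finite collection is attained, so the bound at a fixed competitor is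
    -- applied at a minimiser.
    obtain ⟨i, hi⟩ := exists_eq_ciInf_of_finite (f := fun m : M => (Deconv.biasBound ψ g m ^ 2
      + Deconv.pen a x (Deconv.sigmaSqMix ψ f n) (Deconv.cMix ψ f c n) m))
    obtain ⟨hint, hle⟩ := hreg.risk_le hψ hM hst hind hcov hc ha hn hx i.2 (hr M)
    refine ⟨hint, hle.trans ?_⟩
    rw [← hi]
    have hp := Deconv.pen_nonneg (d := Deconv.cMix ψ f c n) ha (hreg.pairMono_sigmaSqMix n)
      (hx i i.2).le
    have hb := sq_nonneg (Deconv.biasBound ψ g i)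
    have hbp := mul_nonneg hC₀.le (add_nonneg hb hp)
    rw [mul_div_assoc]
    linarith
  · refine ⟨1, one_pos, ?_⟩
    intro g hst Ω _ μ _ X ε hM
    have : IsProbabilityMeasure (μ.map (ε 0)) :=
      Measure.isProbabilityMeasure_map (hM.measurable_ε 0).aemeasurable
    exact absurd ⟨hst.integrable_psi, (hM.density_ε 0).integrable, hst.ft_ne_zero⟩ hreg
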